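/- Let $G$ and $H$ be locally compact (Hausdorff) groups. For a locally compact Hausdorff space $X$ let $M(X)$ be the space of regular complex Borel measures on $X$ with the total variation norm, let $\langle f,\mu\rangle=\int_X f\,d\mu$ for $f\in C_0(X)$, $\mu\in M(X)$, and let the $w^*$-topology of $M(X)$ be $\sigma(M(X),C_0(X))$. $M(G)$ and $M(H)$ carry convolution, and $M(G\times H)$ carries the actions $$a\cdot\nu=(a\otimes\delta_e)*\nu,\qquad \nu\cdot b=\nu*(\delta_e\otimes b)\qquad(a\in M(G),\ b\in M(H),\ \nu\in M(G\times H)).$$ A Banach $\mathfrak A$-$\mathfrak B$-bimodule $E$ is called dual with predual $E_*$ if $E_*$ is a closed submodule of the dual $\mathfrak B$-$\mathfrak A$-bimodule $E^*$ such that the canonical map $E\to(E_*)^*$ is an isometric isomorphism; a Banach algebra is called dual if it is dual as a bimodule over itself; a dual Banach bimodule $E$ over dual Banach algebras $\mathfrak A$, $\mathfrak B$ is called normal if for every $x\in E$ the maps $a\mapsto a\cdot x$ and $b\mapsto x\cdot b$ are $w^*$-$w^*$-continuous. Then: (i) $M(G)$ and $M(H)$ are dual Banach algebras with preduals $C_0(G)$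 and $C_0(H)$, and $M(G\times H)$ is a normal, dual Banach $M(G)$-$M(H)$-bimodule with predual $C_0(G\times H)$. For $f\in C_0(G\times H)$ its actions satisfy $$\langle f,a\cdot\nu\rangle=\int_{G\times H}\int_G f(kg,h)\,da(k)\,d\nu(g,h),\qquad \langle f,\nu\cdot b\rangle=\int_{G\times H}\int_H f(g,hk)\,db(k)\,d\nu(g,h).$$ (ii) Let $\mathcal L=\mathcal L^2_{w^*}(M(G),M(H);\mathbb C)$ be the space of bounded, separately $w^*$-continuous bilinear forms on $M(G)\times M(H)$ with the operator norm. It is closed in the space of all bounded bilinear forms and stable under $(b\cdot\Phi)(\mu,\nu)=\Phi(\mu,\nu*b)$ and $(\Phi\cdot a)(\mu,\nu)=\Phi(a*\mu,\nu)$, so that $\mathcal L^*$ is a Banach $M(G)$-$M(H)$-bimodule under $(a\cdot\xi)(\Phi)=\xi(\Phi\cdot a)$ and $(\xi\cdot b)(\Phi)=\xi(b\cdot\Phi)$. Let $\mathcal{SC}_0(G\times H)$ be the space of bounded functions $f:G\times H\to\mathbb C$ with $f(x,\cdot)\in C_0(H)$ for every $x\in G$ and $f(\cdot,y)\in C_0(G)$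 for every $y\in H$, with the supremum norm. It is identified with $\mathcal L$ through the isometric linear isomorphism $$f\mapsto\Phi_f,\qquad \Phi_f(\mu,\nu)=\int_H\int_G f(x,y)\,d\mu(x)\,d\nu(y).$$ Every $f\in\mathcal{SC}_0(G\times H)$ is integrable with respect to every $\mu\in M(G\times H)$, and the map $$M(G\times H)\to\mathcal L^*,\quad \mu\mapsto\Psi_\mu,\qquad \Psi_\mu(\Phi_f)=\int_{G\times H}f\,d\mu\quad(f\in\mathcal{SC}_0(G\times H)),$$ is a linear isometry and a homomorphism of Banach $M(G)$-$M(H)$-bimodules. -/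

import Mathlib

set_option maxSynthPendingDepth 3
set_option linter.unusedSectionVars false
set_option linter.style.haveILetI false

namespace MeasAlg

open MeasureTheory Set Filter Topology
open scoped ENNReal NNReal ZeroAtInfty

section Aux

variable {X Y Z : Type*}

theorem isFiniteMeasure_variation {mX : MeasurableSpace X} (μ : VectorMeasure X ℂ) :
    IsFiniteMeasure μ.variation := by
  have h : μ.variation ≤ (ComplexMeasure.re μ).totalVariation
      + (ComplexMeasure.im μ).totalVariation := by
    refine VectorMeasure.variation_le_of_forall_enorm_le fun E hE => ?_
    have h1 := SignedMeasure.enorm_le_totalVariation (ComplexMeasure.re μ) E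
    have h2 := SignedMeasure.enorm_le_totalVariation (ComplexMeasure.im μ) E
    rw [Measure.add_apply]
    refine le_trans ?_ (add_le_add h1 h2)
    simp only [ComplexMeasure.re_apply, ComplexMeasure.im_apply]
    rw [← ofReal_norm, ← ofReal_norm, ← ofReal_norm, ← ENNReal.ofReal_add (norm_nonneg _)
      (norm_nonneg _)]
    exact ENNReal.ofReal_le_ofReal (Complex.norm_le_abs_re_add_abs_im _)
  exact isFiniteMeasure_of_le _ h

theorem regular_of_le [TopologicalSpace X] [T2Space X] [MeasurableSpace X] [BorelSpace X]
    {m n : Measure X} [IsFiniteMeasure m] [m.Regular] (h : n ≤ m) : n.Regular := by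
  have hn : IsFiniteMeasure n := isFiniteMeasure_of_le _ h
  have : n.InnerRegular := by
    refine ⟨fun E hE r hr => ?_⟩
    obtain ⟨s, hs, hs'⟩ := exists_between hr
    obtain ⟨K, hKE, hK, hlt⟩ :=
      hE.exists_isCompact_sdiff_lt (measure_ne_top m E) (tsub_pos_of_lt hs).ne'
    refine ⟨K, hKE, hK, ?_⟩
    have h1 : n E ≤ n K + n (E \ K) := by
      refine (measure_mono ?_).trans (measure_union_le K (E \ K))
      simp
    have h2 : n (E \ K) ≤ s - r := (h _).trans hlt.le
    by_contra hcon
    push Not at hcon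
    have h3 : n E ≤ r + (s - r) := h1.trans (add_le_add hcon h2)
    rw [add_tsub_cancel_of_le hs.le] at h3
    exact absurd hs' (not_lt.mpr h3)
  infer_instance

theorem integral_const_smul {mX : MeasurableSpace X} (μ : VectorMeasure X ℂ) (f : X → ℂ) (c : ℂ) :
    μ.integral (fun x => c * f x) (ContinuousLinearMap.mul ℝ ℂ) =
      c * μ.integral f (ContinuousLinearMap.mul ℝ ℂ) := by
  refine setToFun_smul (𝕜 := ℂ) _ ?_ c f
  intro c s x
  simp [VectorMeasure.transpose, mul_left_comm]

theorem integrable_smul_meas {mX : MeasurableSpace X} {μ : VectorMeasure X ℂ} {f : X → ℂ} (c : ℂ)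
    (hf : Integrable f μ.variation) : Integrable f (c • μ).variation := by
  rw [VectorMeasure.variation_smul]
  exact hf.smul_measure_nnreal

theorem integral_smul_meas {mX : MeasurableSpace X} (μ : VectorMeasure X ℂ) (f : X → ℂ) (c : ℂ)
    (hf : Integrable f μ.variation) :
    (c • μ).integral f (ContinuousLinearMap.mul ℝ ℂ) =
      c * μ.integral f (ContinuousLinearMap.mul ℝ ℂ) := by
  have := isFiniteMeasure_variation μ
  have := isFiniteMeasure_variation (c • μ)
  refine Integrable.induction (μ := μ.variation) (fun f : X → ℂ =>
    (c • μ).integral f (ContinuousLinearMap.mul ℝ ℂ) =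
      c * μ.integral f (ContinuousLinearMap.mul ℝ ℂ)) ?_ ?_ ?_ ?_ hf
  · intro a s hs _
    rw [VectorMeasure.integral_indicator_const _ hs, VectorMeasure.integral_indicator_const _ hs]
    simp [mul_left_comm]
  · intro f g _ hf hg h1 h2
    rw [VectorMeasure.integral_add (integrable_smul_meas c hf) (integrable_smul_meas c hg),
      VectorMeasure.integral_add hf hg, h1, h2, mul_add]
  · refine IsSeqClosed.isClosed fun F f hF hFf => ?_
    have h0 : Tendsto (fun n => ∫⁻ x, ‖F n x - f x‖ₑ ∂μ.variation) atTop (𝓝 0) := by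
      have := (tendsto_iff_edist_tendsto_0).1 hFf
      refine this.congr fun n => ?_
      rw [Lp.edist_def, eLpNorm_one_eq_lintegral_enorm]
      rfl
    have h1 := VectorMeasure.tendsto_integral_of_L1 (μ := μ) (B := ContinuousLinearMap.mul ℝ ℂ) f
      (Lp.aestronglyMeasurable f) (.of_forall fun n => L1.integrable_coeFn (F n)) h0
    have h2 := VectorMeasure.tendsto_integral_of_L1 (μ := c • μ)
      (B := ContinuousLinearMap.mul ℝ ℂ) f
      (integrable_smul_meas c (L1.integrable_coeFn f)).aestronglyMeasurable
      (.of_forall fun n => integrable_smul_meas c (L1.integrable_coeFn (F n))) (by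
        rw [VectorMeasure.variation_smul]
        simp only [lintegral_smul_measure, ENNReal.smul_def, smul_eq_mul]
        simpa [ENNReal.smul_def] using ENNReal.Tendsto.const_mul (a := (‖c‖₊ : ℝ≥0∞)) h0
          (Or.inr ENNReal.coe_ne_top))
    refine tendsto_nhds_unique h2 ((h1.const_mul c).congr fun n => (hF n).symm)
  · intro f g hfg _ h
    have hfg' : f =ᵐ[(c • μ).variation] g := by
      rw [VectorMeasure.variation_smul]
      exact Measure.ae_smul_measure hfg _
    rw [← VectorMeasure.integral_congr_ae hfg, ← VectorMeasure.integral_congr_ae hfg', h]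

/-! ### Sections of Borel sets and images of product measures -/

variable [TopologicalSpace X] [T2Space X] [LocallyCompactSpace X] [MeasurableSpace X] [BorelSpace X]
  [TopologicalSpace Y] [T2Space Y] [LocallyCompactSpace Y] [MeasurableSpace Y] [BorelSpace Y]
  [TopologicalSpace Z] [T2Space Z] [MeasurableSpace Z] [BorelSpace Z]
  {φ : X → Y → Z} 

theorem measurableSet_section (hφ : Continuous (Function.uncurry φ)) {E : Set Z}
    (hE : MeasurableSet E) (y : Y) : MeasurableSet {x | φ x y ∈ E} :=
  (hφ.comp (Continuous.prodMk_left y)).measurable hE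

theorem measurable_section_measure (hφ : Continuous (Function.uncurry φ))
    (m : Measure X) [IsFiniteMeasure m] [m.Regular] {E : Set Z} (hE : MeasurableSet E) :
    Measurable fun y => m {x | φ x y ∈ E} := by
  induction E, hE using MeasurableSpace.induction_on_inter
    (show _ = MeasurableSpace.generateFrom {s : Set Z | IsOpen s} from BorelSpace.measurable_eq)
    isPiSystem_isOpen with
  | empty => simp
  | basic U hU =>
    have hU : IsOpen U := hU
    refine LowerSemicontinuous.measurable fun y c hc => ?_
    have hWy : IsOpen {x | φ x y ∈ U} := hU.preimage (hφ.comp (Continuous.prodMk_left y))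
    obtain ⟨K, hKU, hK, hcK⟩ := hWy.exists_lt_isCompact hc
    obtain ⟨u, v, -, hv, hKu, hyv, huv⟩ := generalized_tube_lemma hK (isCompact_singleton (x := y))
      (hU.preimage hφ) (by rintro ⟨x, y'⟩ ⟨hx, rfl⟩; exact hKU hx)
    filter_upwards [hv.mem_nhds (hyv rfl)] with y' hy'
    exact hcK.trans_le (measure_mono fun x hx => by
      have := huv (show (x, y') ∈ u ×ˢ v from ⟨hKu hx, hy'⟩)
      exact this)
  | compl E hE ih =>
    have : (fun y => m {x | φ x y ∈ Eᶜ}) = fun y => m univ - m {x | φ x y ∈ E} := by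
      ext y
      exact measure_compl (measurableSet_section hφ hE y) (measure_ne_top _ _)
    rw [this]
    exact ih.const_sub _
  | iUnion f hd hf ih =>
    have : (fun y => m {x | φ x y ∈ ⋃ i, f i}) = fun y => ∑' i, m {x | φ x y ∈ f i} := by
      ext y
      rw [← measure_iUnion]
      · congr 1; ext x; simp
      · intro i j hij
        exact (hd hij).preimage (fun x => φ x y)
      · exact fun i => measurableSet_section hφ (hf i) y
    rw [this]
    exact Measurable.tsum ih

theorem measurable_section_complex (hφ : Continuous (Function.uncurry φ))
    (μ : VectorMeasure X ℂ) (hμ : μ.variation.Regular) {E : Set Z} (hE : MeasurableSet E) :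
    Measurable fun y => μ {x | φ x y ∈ E} := by
  have := isFiniteMeasure_variation μ
  have key : ∀ s : SignedMeasure X, s.variation ≤ μ.variation →
      Measurable fun y => s {x | φ x y ∈ E} := by
    intro s hs
    rw [← SignedMeasure.totalVariation_eq_variation] at hs
    have h1 : s.toJordanDecomposition.posPart.Regular :=
      regular_of_le (m := μ.variation) (le_trans (Measure.le_add_right le_rfl) hs)
    have h2 : s.toJordanDecomposition.negPart.Regular :=
      regular_of_le (m := μ.variation) (le_trans (Measure.le_add_left le_rfl) hs)
    have : (fun y => s {x | φ x y ∈ E}) = fun y =>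
        (s.toJordanDecomposition.posPart {x | φ x y ∈ E}).toReal -
        (s.toJordanDecomposition.negPart {x | φ x y ∈ E}).toReal := by
      ext y
      exact s.apply_eq_posPart_real_sub_negPart_real (measurableSet_section hφ hE y)
    rw [this]
    exact (measurable_section_measure hφ _ hE).ennreal_toReal.sub
      (measurable_section_measure hφ _ hE).ennreal_toReal
  have hre := key (ComplexMeasure.re μ) (by
    refine VectorMeasure.variation_le_of_forall_enorm_le fun A hA => ?_
    refine le_trans ?_ (μ.enorm_measure_le_variation A)
    rw [← ofReal_norm, ← ofReal_norm]
    exact ENNReal.ofReal_le_ofReal (Complex.abs_re_le_norm _))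
  have him := key (ComplexMeasure.im μ) (by
    refine VectorMeasure.variation_le_of_forall_enorm_le fun A hA => ?_
    refine le_trans ?_ (μ.enorm_measure_le_variation A)
    rw [← ofReal_norm, ← ofReal_norm]
    exact ENNReal.ofReal_le_ofReal (Complex.abs_im_le_norm _))
  have : (fun y => μ {x | φ x y ∈ E}) = fun y =>
      ((ComplexMeasure.re μ {x | φ x y ∈ E} : ℝ) : ℂ)
        + ((ComplexMeasure.im μ {x | φ x y ∈ E} : ℝ) : ℂ) * Complex.I := by
    ext y
    exact (Complex.re_add_im _).symm
  rw [this]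
  exact (Complex.measurable_ofReal.comp hre).add
    ((Complex.measurable_ofReal.comp him).mul_const _)

/-- The image under `φ` of the product of two finite regular measures. -/
noncomputable def pushMeasure (φ : X → Y → Z) (m : Measure X) (n : Measure Y) : Measure Z :=
  n.bind fun y => m.map fun x => φ x y

theorem pushMeasure_apply (hφ : Continuous (Function.uncurry φ))
    (m : Measure X) [IsFiniteMeasure m] [m.Regular] (n : Measure Y) {E : Set Z}
    (hE : MeasurableSet E) : pushMeasure φ m n E = ∫⁻ y, m {x | φ x y ∈ E} ∂n := by
  have hm : ∀ y, Measurable fun x => φ x y := fun y =>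
    (hφ.comp (Continuous.prodMk_left y)).measurable
  have h : Measurable fun y => m.map fun x => φ x y := by
    refine Measure.measurable_of_measurable_coe _ fun A hA => ?_
    simp_rw [Measure.map_apply (hm _) hA]
    exact measurable_section_measure hφ m hA
  rw [pushMeasure, Measure.bind_apply hE h.aemeasurable]
  simp_rw [Measure.map_apply (hm _) hE]
  rfl

theorem isFiniteMeasure_pushMeasure (hφ : Continuous (Function.uncurry φ))
    (m : Measure X) [IsFiniteMeasure m] [m.Regular] (n : Measure Y) [IsFiniteMeasure n] :
    IsFiniteMeasure (pushMeasure φ m n) := by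
  refine ⟨?_⟩
  rw [pushMeasure_apply hφ m n MeasurableSet.univ]
  simp only [mem_univ, ofPred_true, lintegral_const]
  exact ENNReal.mul_lt_top (measure_lt_top _ _) (measure_lt_top _ _)

theorem exists_isCompact_pushMeasure (hφ : Continuous (Function.uncurry φ))
    (m : Measure X) [IsFiniteMeasure m] [m.Regular] (n : Measure Y) [IsFiniteMeasure n] [n.Regular]
    {U : Set Z} (hU : IsOpen U) {ε : ℝ≥0} (hε : 0 < ε) :
    ∃ K ⊆ U, IsCompact K ∧
      pushMeasure φ m n U ≤ pushMeasure φ m n K + (ε + (ε * n univ + m univ * ε)) := by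
  set W : Set (X × Y) := Function.uncurry φ ⁻¹' U with hW
  have hWo : IsOpen W := hU.preimage hφ
  have hfin : ∫⁻ y, ((m {x | φ x y ∈ U}).toNNReal : ℝ≥0∞) ∂n ≠ ∞ := by
    have h1 : ∫⁻ y, ((m {x | φ x y ∈ U}).toNNReal : ℝ≥0∞) ∂n ≤ ∫⁻ _, m univ ∂n :=
      lintegral_mono fun y => by
        rw [ENNReal.coe_toNNReal (measure_ne_top _ _)]
        exact measure_mono (subset_univ _)
    refine (h1.trans_lt ?_).ne
    rw [lintegral_const]
    exact ENNReal.mul_lt_top (measure_lt_top _ _) (measure_lt_top _ _)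
  obtain ⟨u, hug, husc, hint⟩ := exists_upperSemicontinuous_le_lintegral_le
    (fun y => (m {x | φ x y ∈ U}).toNNReal) hfin (ENNReal.coe_pos.2 hε).ne'
  have hug' : ∀ y, (u y : ℝ≥0∞) ≤ m {x | φ x y ∈ U} := fun y => by
    rw [← ENNReal.coe_toNNReal (measure_ne_top m {x | φ x y ∈ U})]
    exact ENNReal.coe_le_coe.2 (hug y)
  -- local approximation by compact rectangles
  have hloc : ∀ y, ∃ (A : Set X) (V : Set Y), IsCompact A ∧ IsCompact V ∧ V ∈ 𝓝 y ∧
      A ×ˢ V ⊆ W ∧ ∀ y' ∈ V, (u y' : ℝ≥0∞) ≤ m A + ε := by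
    intro y
    have hWy : IsOpen {x | φ x y ∈ U} := hU.preimage (hφ.comp (Continuous.prodMk_left y))
    obtain ⟨A, hAU, hA, hlt⟩ : ∃ A ⊆ {x | φ x y ∈ U}, IsCompact A ∧
        (u y : ℝ≥0∞) < m A + ε := by
      obtain ⟨A, hAU, hA, h⟩ := hWy.measurableSet.exists_isCompact_lt_add
        (measure_ne_top m _) (ENNReal.coe_pos.2 hε).ne'
      exact ⟨A, hAU, hA, (hug' y).trans_lt h⟩
    obtain ⟨p, v, -, hv, hAp, hyv, hpv⟩ := generalized_tube_lemma hA
      (isCompact_singleton (x := y)) hWo (by rintro ⟨x, y'⟩ ⟨hx, rfl⟩; exact hAU hx)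
    have hne : m A + ε ≠ ∞ := ENNReal.add_ne_top.2 ⟨measure_ne_top _ _, ENNReal.coe_ne_top⟩
    have hlt' : u y < (m A + ε).toNNReal := by
      rw [← ENNReal.coe_lt_coe, ENNReal.coe_toNNReal hne]
      exact hlt
    have hnh : v ∩ {y' | u y' < (m A + ε).toNNReal} ∈ 𝓝 y :=
      inter_mem (hv.mem_nhds (hyv rfl)) (husc y _ hlt')
    obtain ⟨V, hV, hVsub, hVc⟩ := local_compact_nhds hnh
    refine ⟨A, V, hA, hVc, hV, fun z hz => hpv ⟨hAp hz.1, (hVsub hz.2).1⟩, fun y' hy' => ?_⟩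
    have := (hVsub hy').2
    rw [← ENNReal.coe_toNNReal hne]
    exact ENNReal.coe_le_coe.2 (le_of_lt this)
  choose A V hA hV hVn hAV huA using hloc
  obtain ⟨C, -, hC, hCε⟩ := MeasurableSet.univ.exists_isCompact_sdiff_lt (measure_ne_top n univ)
    (ENNReal.coe_pos.2 hε).ne'
  obtain ⟨t, -, htC⟩ := hC.elim_nhds_subcover V fun y _ => hVn y
  set L : Set (X × Y) := ⋃ y ∈ t, A y ×ˢ V y with hL
  have hLc : IsCompact L := t.isCompact_biUnion fun y _ => (hA y).prod (hV y)
  have hLW : L ⊆ W := iUnion₂_subset fun y _ => hAV y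
  refine ⟨Function.uncurry φ '' L, image_subset_iff.2 hLW, hLc.image hφ, ?_⟩
  have hKc : IsCompact (Function.uncurry φ '' L) := hLc.image hφ
  rw [pushMeasure_apply hφ m n hU.measurableSet, pushMeasure_apply hφ m n hKc.measurableSet]
  have hpt : ∀ y, (u y : ℝ≥0∞) ≤
      m {x | φ x y ∈ Function.uncurry φ '' L} + ε + Cᶜ.indicator (fun _ => m univ) y := by
    intro y
    by_cases hy : y ∈ C
    · obtain ⟨y₀, hy₀, hyV⟩ := mem_iUnion₂.1 (htC hy)
      refine le_trans (huA y₀ y hyV) (le_trans ?_ le_self_add)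
      gcongr
      intro x hx
      exact ⟨(x, y), mem_iUnion₂.2 ⟨y₀, hy₀, hx, hyV⟩, rfl⟩
    · rw [indicator_of_mem (show y ∈ Cᶜ from hy)]
      exact le_trans ((hug' y).trans (measure_mono (subset_univ _))) le_add_self
  have h1 : ∫⁻ y, (u y : ℝ≥0∞) ∂n ≤ ∫⁻ y, m {x | φ x y ∈ Function.uncurry φ '' L} ∂n
      + (ε * n univ + m univ * ε) := by
    refine (lintegral_mono hpt).trans ?_
    rw [lintegral_add_right _ (measurable_const.indicator hC.measurableSet.compl),
      lintegral_add_right _ measurable_const, lintegral_const,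
      lintegral_indicator_const hC.measurableSet.compl, add_assoc]
    gcongr
    rw [compl_eq_univ_sdiff]
    exact hCε.le
  have h2 : ∫⁻ y, m {x | φ x y ∈ U} ∂n =
      ∫⁻ y, ((m {x | φ x y ∈ U}).toNNReal : ℝ≥0∞) ∂n :=
    lintegral_congr fun y => (ENNReal.coe_toNNReal (measure_ne_top _ _)).symm
  rw [h2]
  calc _ ≤ ∫⁻ y, (u y : ℝ≥0∞) ∂n + ε := hint
    _ ≤ _ := add_le_add_left h1 _
    _ = _ := by ring

theorem regular_pushMeasure (hφ : Continuous (Function.uncurry φ))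
    (m : Measure X) [IsFiniteMeasure m] [m.Regular] (n : Measure Y) [IsFiniteMeasure n]
    [n.Regular] : (pushMeasure φ m n).Regular := by
  have := isFiniteMeasure_pushMeasure hφ m n
  have hin : (pushMeasure φ m n).InnerRegularWRT IsCompact IsOpen := by
    intro U hU r hr
    by_contra hcon
    push Not at hcon
    have hle : ∀ ε : ℝ≥0, 0 < ε →
        pushMeasure φ m n U ≤ r + (ε + (ε * n univ + m univ * ε)) := fun ε hε => by
      obtain ⟨K, hKU, hK, h⟩ := exists_isCompact_pushMeasure hφ m n hU hε
      exact h.trans (add_le_add_left (hcon K hKU hK) _)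
    have ht : Tendsto (fun ε : ℝ≥0 => r + ((ε : ℝ≥0∞) + (ε * n univ + m univ * ε)))
        (𝓝[>] 0) (𝓝 (r + (((0 : ℝ≥0) : ℝ≥0∞) +
          (((0 : ℝ≥0) : ℝ≥0∞) * n univ + m univ * ((0 : ℝ≥0) : ℝ≥0∞))))) := by
      have hc : Tendsto (fun ε : ℝ≥0 => (ε : ℝ≥0∞)) (𝓝[>] 0) (𝓝 ((0 : ℝ≥0) : ℝ≥0∞)) :=
        (ENNReal.tendsto_coe.2 tendsto_id).mono_left nhdsWithin_le_nhds
      refine tendsto_const_nhds.add (hc.add (Tendsto.add ?_ ?_))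
      · exact ENNReal.Tendsto.mul_const hc (Or.inr (measure_ne_top _ _))
      · exact ENNReal.Tendsto.const_mul hc (Or.inr (measure_ne_top _ _))
    have := ge_of_tendsto ht (eventually_mem_nhdsWithin.mono fun ε hε => hle ε hε)
    simp only [ENNReal.coe_zero, zero_mul, mul_zero, add_zero] at this
    exact absurd hr (not_lt.2 this)
  have hw : (pushMeasure φ m n).WeaklyRegular :=
    Measure.InnerRegularWRT.weaklyRegular_of_finite _ fun U hU r hr => by
      obtain ⟨K, hKU, hK, h⟩ := hin hU r hr
      exact ⟨K, hKU, hK.isClosed, h⟩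
  exact { innerRegular := hin }

/-- The image under `φ` of the product of two regular complex measures: the mass of a Borel set
`E` is `∫ μ {x | φ x y ∈ E} dν(y)`. -/
noncomputable def pushVectorMeasure (hφ : Continuous (Function.uncurry φ)) (μ : VectorMeasure X ℂ)
    (hμ : μ.variation.Regular) (ν : VectorMeasure Y ℂ) : VectorMeasure Z ℂ where
  measureOf' E := open scoped Classical in
    if MeasurableSet E then ν.integral (fun y => μ {x | φ x y ∈ E}) (ContinuousLinearMap.mul ℝ ℂ)
    else 0
  empty' := by simp
  not_measurable' := by simp +contextual
  m_iUnion' f f_meas f_disj := by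
    have := isFiniteMeasure_variation ν
    have hint : ∀ i, Integrable (fun y => μ {x | φ x y ∈ f i}) ν.variation := fun i =>
      Integrable.of_bound (measurable_section_complex hφ μ hμ (f_meas i)).aestronglyMeasurable
        μ.bound (.of_forall fun y => VectorMeasure.norm_apply_le_bound)
    simp only [f_meas, ↓reduceIte, implies_true, MeasurableSet.iUnion,
      HasSum, SummationFilter.unconditional_filter]
    have A (a : Finset ℕ) : ∑ i ∈ a,
        ν.integral (fun y => μ {x | φ x y ∈ f i}) (ContinuousLinearMap.mul ℝ ℂ) =
        ν.integral (fun y => ∑ i ∈ a, μ {x | φ x y ∈ f i}) (ContinuousLinearMap.mul ℝ ℂ) := by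
      rw [VectorMeasure.integral_finsetSum _ fun i _ => hint i]
    simp_rw [A]
    apply VectorMeasure.tendsto_integral_filter_of_dominated_convergence
      (bound := fun _ => (μ.bound : ℝ))
    · exact Eventually.of_forall fun a =>
        (integrable_finsetSum a fun i _ => hint i).aestronglyMeasurable
    · filter_upwards with a
      filter_upwards with y
      rw [← VectorMeasure.of_biUnion_finset]
      · apply VectorMeasure.norm_apply_le_bound
      · exact fun i hi j hj hij => (f_disj hij).preimage fun x => φ x y
      · exact fun i hi => measurableSet_section hφ (f_meas i) y
    · apply integrable_const
    · filter_upwards with y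
      have : {x | φ x y ∈ ⋃ i, f i} = ⋃ i, {x | φ x y ∈ f i} := by ext; simp
      rw [this]
      apply VectorMeasure.hasSum_of_disjoint_iUnion
      · exact fun i => measurableSet_section hφ (f_meas i) y
      · exact fun i j hij => (f_disj hij).preimage fun x => φ x y

theorem pushVectorMeasure_apply (hφ : Continuous (Function.uncurry φ)) (μ : VectorMeasure X ℂ)
    (hμ : μ.variation.Regular) (ν : VectorMeasure Y ℂ) {E : Set Z} (hE : MeasurableSet E) :
    pushVectorMeasure hφ μ hμ ν E =
      ν.integral (fun y => μ {x | φ x y ∈ E}) (ContinuousLinearMap.mul ℝ ℂ) :=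
  if_pos hE

theorem integrable_section (hφ : Continuous (Function.uncurry φ)) (μ : VectorMeasure X ℂ)
    (hμ : μ.variation.Regular) (ν : VectorMeasure Y ℂ) {E : Set Z} (hE : MeasurableSet E) :
    Integrable (fun y => μ {x | φ x y ∈ E}) ν.variation :=
  have := isFiniteMeasure_variation ν
  Integrable.of_bound (measurable_section_complex hφ μ hμ hE).aestronglyMeasurable
    μ.bound (.of_forall fun _ => VectorMeasure.norm_apply_le_bound)

theorem variation_pushVectorMeasure_le (hφ : Continuous (Function.uncurry φ))
    (μ : VectorMeasure X ℂ) (hμ : μ.variation.Regular) (ν : VectorMeasure Y ℂ) :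
    (pushVectorMeasure hφ μ hμ ν).variation ≤ pushMeasure φ μ.variation ν.variation := by
  have := isFiniteMeasure_variation μ
  refine VectorMeasure.variation_le_of_forall_enorm_le fun E hE => ?_
  rw [pushVectorMeasure_apply hφ μ hμ ν hE, pushMeasure_apply hφ _ _ hE]
  refine VectorMeasure.enorm_integral_le_lintegral_enorm.trans ?_
  have h1 : ‖ContinuousLinearMap.mul ℝ ℂ‖ₑ ≤ 1 := by
    rw [← ofReal_norm, ← ENNReal.ofReal_one]
    exact ENNReal.ofReal_le_ofReal (ContinuousLinearMap.opNorm_mul_le ℝ ℂ)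
  refine (mul_le_mul_left h1 _).trans ?_
  rw [one_mul]
  exact lintegral_mono fun y => μ.enorm_measure_le_variation _

theorem regular_pushVectorMeasure (hφ : Continuous (Function.uncurry φ))
    (μ : VectorMeasure X ℂ) (hμ : μ.variation.Regular) (ν : VectorMeasure Y ℂ)
    (hν : ν.variation.Regular) : (pushVectorMeasure hφ μ hμ ν).variation.Regular := by
  have := isFiniteMeasure_variation μ
  have := isFiniteMeasure_variation ν
  have := isFiniteMeasure_pushMeasure hφ μ.variation ν.variation
  have := regular_pushMeasure hφ μ.variation ν.variation
  exact regular_of_le (variation_pushVectorMeasure_le hφ μ hμ ν)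

end Aux


/-! ### The space `M(X)` of regular complex Borel measures -/

section RegMeas

/-- The complex Borel measures on `X` whose total variation is a regular measure. -/
noncomputable def regularMeasures (X : Type*) [TopologicalSpace X] [T2Space X] :
    Submodule ℂ (@VectorMeasure X (borel X) ℂ _ _) :=
  letI : MeasurableSpace X := borel X
  haveI : BorelSpace X := ⟨rfl⟩
  { carrier := {μ | μ.variation.Regular}
    add_mem' := fun {μ ν} hμ hν => by
      have := isFiniteMeasure_variation μ
      have := isFiniteMeasure_variation ν
      have : μ.variation.Regular := hμ
      have : ν.variation.Regular := hν
      have : (μ.variation + ν.variation).Regular := inferInstance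
      exact regular_of_le VectorMeasure.variation_add_le
    zero_mem' := by
      change (0 : VectorMeasure X ℂ).variation.Regular
      rw [VectorMeasure.variation_zero]
      infer_instance
    smul_mem' := fun c μ hμ => by
      have : μ.variation.Regular := hμ
      change (c • μ).variation.Regular
      rw [VectorMeasure.variation_smul]
      infer_instance }

/-- `M(X)`: the space of regular complex Borel measures on the Hausdorff space `X`. -/
def RegMeas (X : Type*) [TopologicalSpace X] [T2Space X] : Type _ := ↥(regularMeasures X)

namespace RegMeas

variable {X : Type*} [TopologicalSpace X] [T2Space X]

noncomputable instance : AddCommGroup (RegMeas X) :=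
  inferInstanceAs (AddCommGroup ↥(regularMeasures X))

noncomputable instance : Module ℂ (RegMeas X) :=
  inferInstanceAs (Module ℂ ↥(regularMeasures X))

/-- The underlying complex measure on the Borel σ-algebra. -/
def toMeas (μ : RegMeas X) : @VectorMeasure X (borel X) ℂ _ _ := μ.1

/-- The total variation measure `|μ|`. -/
noncomputable def tv (μ : RegMeas X) : @Measure X (borel X) :=
  letI : MeasurableSpace X := borel X
  μ.toMeas.variation

theorem toMeas_add (μ ν : RegMeas X) : (μ + ν).toMeas = μ.toMeas + ν.toMeas := rfl

theorem toMeas_smul (c : ℂ) (μ : RegMeas X) : (c • μ).toMeas = c • μ.toMeas := rfl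

theorem toMeas_injective : Function.Injective (toMeas (X := X)) := Subtype.val_injective

theorem ext_meas {μ ν : RegMeas X} (h : ∀ E, MeasurableSet[borel X] E → μ.toMeas E = ν.toMeas E) :
    μ = ν :=
  toMeas_injective (VectorMeasure.ext (m := borel X) h)

theorem regular_tv (μ : RegMeas X) : @Measure.Regular X (borel X) _ μ.tv := μ.2

theorem isFiniteMeasure_tv (μ : RegMeas X) : @IsFiniteMeasure X (borel X) μ.tv :=
  isFiniteMeasure_variation (mX := borel X) μ.toMeas

/-- The total variation norm `‖μ‖ = |μ|(X)`. -/
noncomputable instance : Norm (RegMeas X) := ⟨fun μ => (μ.tv univ).toReal⟩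

theorem norm_def (μ : RegMeas X) : ‖μ‖ = (μ.tv univ).toReal := rfl

theorem ofReal_norm_eq (μ : RegMeas X) : ENNReal.ofReal ‖μ‖ = μ.tv univ := by
  letI : MeasurableSpace X := borel X
  have := isFiniteMeasure_tv μ
  exact ENNReal.ofReal_toReal (measure_ne_top _ _)

theorem normCore : NormedSpace.Core ℂ (RegMeas X) := by
  letI : MeasurableSpace X := borel X
  refine { norm_nonneg := fun μ => ENNReal.toReal_nonneg, norm_smul := fun c μ => ?_,
           norm_triangle := fun μ ν => ?_, norm_eq_zero_iff := fun μ => ⟨fun h => ?_, ?_⟩ }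
  · rw [norm_def, norm_def, tv, tv, toMeas_smul, VectorMeasure.variation_smul, Measure.smul_apply,
      ENNReal.smul_def, smul_eq_mul, ENNReal.toReal_mul]
    rfl
  · have := isFiniteMeasure_tv μ
    have := isFiniteMeasure_tv ν
    rw [norm_def, norm_def, norm_def, ← ENNReal.toReal_add (measure_ne_top _ _)
      (measure_ne_top _ _)]
    refine ENNReal.toReal_mono (ENNReal.add_ne_top.2 ⟨measure_ne_top _ _, measure_ne_top _ _⟩) ?_
    exact VectorMeasure.variation_add_le (μ := μ.toMeas) (ν := ν.toMeas) univ
  · have h1 : μ.tv univ = 0 := by rw [← ofReal_norm_eq, h, ENNReal.ofReal_zero]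
    have h2 : μ.toMeas.variation = 0 := Measure.measure_univ_eq_zero.1 h1
    exact toMeas_injective (VectorMeasure.variation_eq_zero.1 h2)
  · rintro rfl
    rw [norm_def, tv]
    change ((0 : VectorMeasure X ℂ).variation univ).toReal = 0
    simp

noncomputable instance : NormedAddCommGroup (RegMeas X) := NormedAddCommGroup.ofCore normCore

noncomputable instance : NormedSpace ℂ (RegMeas X) := NormedSpace.ofCore normCore

/-- `f` is measurable with respect to `|μ|` and `∫ |f| d|μ| < ∞`. -/
def IntegrableFun (μ : RegMeas X) (f : X → ℂ) : Prop := 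
  letI : MeasurableSpace X := borel X
  Integrable f μ.tv

/-- The integral `∫ f dμ` of a complex function against a complex measure. -/
noncomputable def integral (μ : RegMeas X) (f : X → ℂ) : ℂ :=
  letI : MeasurableSpace X := borel X
  μ.toMeas.integral f (ContinuousLinearMap.mul ℝ ℂ)

theorem integrableFun_of_bound (μ : RegMeas X) {f : X → ℂ} (hf : Continuous f) (C : ℝ)
    (hC : ∀ x, ‖f x‖ ≤ C) : μ.IntegrableFun f := by
  letI : MeasurableSpace X := borel X
  haveI : BorelSpace X := ⟨rfl⟩
  have := isFiniteMeasure_tv μ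
  exact Integrable.of_bound hf.measurable.aestronglyMeasurable C (.of_forall hC)

theorem norm_integral_le (μ : RegMeas X) (f : X → ℂ) (C : ℝ) (hC0 : 0 ≤ C)
    (hC : ∀ x, ‖f x‖ ≤ C) : ‖μ.integral f‖ ≤ C * ‖μ‖ := by
  letI : MeasurableSpace X := borel X
  have : IsFiniteMeasure μ.toMeas.variation := isFiniteMeasure_tv μ
  refine (VectorMeasure.norm_integral_le_of_norm_le_const (μ := μ.toMeas) (f := f) (C := C)
    (B := ContinuousLinearMap.mul ℝ ℂ) (.of_forall hC)).trans ?_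
  have h1 : C * ‖ContinuousLinearMap.mul ℝ ℂ‖ ≤ C * 1 :=
    mul_le_mul_of_nonneg_left (ContinuousLinearMap.opNorm_mul_le ℝ ℂ) hC0
  rw [mul_one] at h1
  exact mul_le_mul_of_nonneg_right h1 measureReal_nonneg

theorem integrableFun_C0 (μ : RegMeas X) (f : C₀(X, ℂ)) : μ.IntegrableFun f :=
  μ.integrableFun_of_bound f.continuous ‖f‖ fun x => f.toBCF.norm_coe_le_norm x

/-- The pairing `⟨f, μ⟩ = ∫ f dμ`, as a map from `C₀(X)` into the dual space of `M(X)`. -/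
noncomputable def pairing (X : Type*) [TopologicalSpace X] [T2Space X] :
    C₀(X, ℂ) →L[ℂ] StrongDual ℂ (RegMeas X) :=
  LinearMap.mkContinuous₂
    (LinearMap.mk₂ ℂ (fun (f : C₀(X, ℂ)) (μ : RegMeas X) => μ.integral f)
      (fun f g μ => @VectorMeasure.integral_add X ℂ ℂ ℂ (borel X) _ _ _ _ _ _ f g μ.toMeas
        (ContinuousLinearMap.mul ℝ ℂ) (μ.integrableFun_C0 f) (μ.integrableFun_C0 g))
      (fun c f μ => @integral_const_smul X (borel X) μ.toMeas f c)
      (fun f μ ν => @VectorMeasure.integral_add_vectorMeasure X ℂ ℂ ℂ (borel X) _ _ _ _ _ _ f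
        μ.toMeas ν.toMeas (ContinuousLinearMap.mul ℝ ℂ) (μ.integrableFun_C0 f)
        (ν.integrableFun_C0 f))
      (fun c f μ => @integral_smul_meas X (borel X) μ.toMeas f c (μ.integrableFun_C0 f)))
    1 fun f μ => by
      rw [one_mul]
      exact μ.norm_integral_le f ‖f‖ (norm_nonneg _) fun x => f.toBCF.norm_coe_le_norm x

theorem pairing_apply (f : C₀(X, ℂ)) (μ : RegMeas X) : pairing X f μ = μ.integral f := rfl

/-- The predual `C₀(X)` of `M(X)`, as a space of functionals on `M(X)`. -/
noncomputable def predual (X : Type*) [TopologicalSpace X] [T2Space X] :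
    Submodule ℂ (StrongDual ℂ (RegMeas X)) := (pairing X).range

/-- The point mass `δ_x`. -/
noncomputable def dirac (x : X) : RegMeas X :=
  ⟨letI : MeasurableSpace X := borel X; VectorMeasure.dirac x 1, by
    letI : MeasurableSpace X := borel X
    haveI : BorelSpace X := ⟨rfl⟩
    change (VectorMeasure.dirac x (1 : ℂ)).variation.Regular
    rw [VectorMeasure.variation_dirac]
    have : (Measure.dirac x).InnerRegular := by
      refine ⟨fun E hE r hr => ?_⟩
      by_cases hx : x ∈ E
      · exact ⟨{x}, singleton_subset_iff.2 hx, isCompact_singleton, by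
          simpa [hx, hE] using hr⟩
      · simp [hx, hE] at hr
    have : (Measure.dirac x).Regular := inferInstance
    simpa using this⟩

variable {Y Z : Type*} [LocallyCompactSpace X] [TopologicalSpace Y] [T2Space Y]
  [LocallyCompactSpace Y] [TopologicalSpace Z] [T2Space Z]

/-- For continuous `φ : X × Y → Z`, the image under `φ` of the product of `μ` and `ν`. -/
noncomputable def pushProdFun (φ : C(X × Y, Z)) (μ : RegMeas X) (ν : RegMeas Y) : RegMeas Z :=
  letI : MeasurableSpace X := borel X
  haveI : BorelSpace X := ⟨rfl⟩
  letI : MeasurableSpace Y := borel Y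
  haveI : BorelSpace Y := ⟨rfl⟩
  letI : MeasurableSpace Z := borel Z
  haveI : BorelSpace Z := ⟨rfl⟩
  ⟨pushVectorMeasure (φ := fun x y => φ (x, y)) φ.continuous μ.toMeas μ.regular_tv ν.toMeas,
    regular_pushVectorMeasure (φ := fun x y => φ (x, y)) φ.continuous μ.toMeas μ.regular_tv
      ν.toMeas ν.regular_tv⟩

theorem pushProdFun_apply (φ : C(X × Y, Z)) (μ : RegMeas X) (ν : RegMeas Y) {E : Set Z}
    (hE : MeasurableSet[borel Z] E) :
    (pushProdFun φ μ ν).toMeas E = ν.integral fun y => μ.toMeas {x | φ (x, y) ∈ E} :=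
  if_pos hE

theorem integrableFun_section (φ : C(X × Y, Z)) (μ : RegMeas X) (ν : RegMeas Y) {E : Set Z}
    (hE : MeasurableSet[borel Z] E) :
    ν.IntegrableFun fun y => μ.toMeas {x | φ (x, y) ∈ E} := by
  letI : MeasurableSpace X := borel X
  haveI : BorelSpace X := ⟨rfl⟩
  letI : MeasurableSpace Y := borel Y
  haveI : BorelSpace Y := ⟨rfl⟩
  letI : MeasurableSpace Z := borel Z
  haveI : BorelSpace Z := ⟨rfl⟩
  exact integrable_section (φ := fun x y => φ (x, y)) φ.continuous μ.toMeas μ.regular_tv ν.toMeas hE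

theorem norm_pushProdFun_le (φ : C(X × Y, Z)) (μ : RegMeas X) (ν : RegMeas Y) :
    ‖pushProdFun φ μ ν‖ ≤ ‖μ‖ * ‖ν‖ := by
  letI : MeasurableSpace X := borel X
  haveI : BorelSpace X := ⟨rfl⟩
  letI : MeasurableSpace Y := borel Y
  haveI : BorelSpace Y := ⟨rfl⟩
  letI : MeasurableSpace Z := borel Z
  haveI : BorelSpace Z := ⟨rfl⟩
  have : IsFiniteMeasure μ.toMeas.variation := isFiniteMeasure_tv μ
  have : IsFiniteMeasure ν.toMeas.variation := isFiniteMeasure_tv ν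
  have : μ.toMeas.variation.Regular := regular_tv μ
  have h := variation_pushVectorMeasure_le (φ := fun x y => φ (x, y)) φ.continuous μ.toMeas
    μ.regular_tv ν.toMeas univ
  rw [pushMeasure_apply (φ := fun x y => φ (x, y)) φ.continuous _ _ MeasurableSet.univ] at h
  simp only [mem_univ, ofPred_true, lintegral_const] at h
  rw [norm_def μ, norm_def ν, ← ENNReal.toReal_mul]
  exact ENNReal.toReal_mono (ENNReal.mul_ne_top (measure_ne_top μ.toMeas.variation _)
    (measure_ne_top ν.toMeas.variation _)) h

/-- For continuous `φ : X × Y → Z`, the bounded bilinear map taking `(μ, ν)` to the image under `φ`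
of the product of `μ` and `ν`, that is, to the measure `E ↦ ∫ μ {x | φ (x, y) ∈ E} dν(y)`. -/
noncomputable def pushProd (φ : C(X × Y, Z)) : RegMeas X →L[ℂ] RegMeas Y →L[ℂ] RegMeas Z :=
  LinearMap.mkContinuous₂
    (LinearMap.mk₂ ℂ (pushProdFun φ)
      (fun μ μ' ν => ext_meas fun E hE => by
        rw [toMeas_add]
        change _ = (pushProdFun φ μ ν).toMeas E + (pushProdFun φ μ' ν).toMeas E
        rw [pushProdFun_apply φ _ _ hE, pushProdFun_apply φ _ _ hE, pushProdFun_apply φ _ _ hE]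
        exact @VectorMeasure.integral_add Y ℂ ℂ ℂ (borel Y) _ _ _ _ _ _ _ _ ν.toMeas
          (ContinuousLinearMap.mul ℝ ℂ) (integrableFun_section φ μ ν hE)
          (integrableFun_section φ μ' ν hE))
      (fun c μ ν => ext_meas fun E hE => by
        rw [toMeas_smul]
        change _ = c * (pushProdFun φ μ ν).toMeas E
        rw [pushProdFun_apply φ _ _ hE, pushProdFun_apply φ _ _ hE]
        exact @integral_const_smul Y (borel Y) ν.toMeas _ c)
      (fun μ ν ν' => ext_meas fun E hE => by
        rw [toMeas_add]
        change _ = (pushProdFun φ μ ν).toMeas E + (pushProdFun φ μ ν').toMeas E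
        rw [pushProdFun_apply φ _ _ hE, pushProdFun_apply φ _ _ hE, pushProdFun_apply φ _ _ hE]
        exact @VectorMeasure.integral_add_vectorMeasure Y ℂ ℂ ℂ (borel Y) _ _ _ _ _ _ _
          ν.toMeas ν'.toMeas (ContinuousLinearMap.mul ℝ ℂ) (integrableFun_section φ μ ν hE)
          (integrableFun_section φ μ ν' hE))
      (fun c μ ν => ext_meas fun E hE => by
        rw [toMeas_smul]
        change _ = c * (pushProdFun φ μ ν).toMeas E
        rw [pushProdFun_apply φ _ _ hE, pushProdFun_apply φ _ _ hE]
        exact @integral_smul_meas Y (borel Y) ν.toMeas _ c (integrableFun_section φ μ ν hE)))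
    1 fun μ ν => by
      rw [one_mul]
      exact norm_pushProdFun_le φ μ ν

theorem pushProd_apply (φ : C(X × Y, Z)) (μ : RegMeas X) (ν : RegMeas Y) {E : Set Z}
    (hE : MeasurableSet[borel Z] E) :
    (pushProd φ μ ν).toMeas E = ν.integral fun y => μ.toMeas {x | φ (x, y) ∈ E} :=
  pushProdFun_apply φ μ ν hE

/-- The product measure `μ ⊗ ν`, as a regular Borel measure on `X × Y`. -/
noncomputable def tensor (X Y : Type*) [TopologicalSpace X] [T2Space X] [LocallyCompactSpace X]
    [TopologicalSpace Y] [T2Space Y] [LocallyCompactSpace Y] :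
    RegMeas X →L[ℂ] RegMeas Y →L[ℂ] RegMeas (X × Y) :=
  pushProd (ContinuousMap.id (X × Y))

section Groups

variable (G H : Type*)
  [Group G] [TopologicalSpace G] [IsTopologicalGroup G] [T2Space G] [LocallyCompactSpace G]
  [Group H] [TopologicalSpace H] [IsTopologicalGroup H] [T2Space H] [LocallyCompactSpace H]

/-- Convolution `μ * ν` on `M(G)`: the image of the product measure under multiplication,
`(μ * ν)(E) = ∫ μ {x | x y ∈ E} dν(y)`. -/
noncomputable def conv : RegMeas G →L[ℂ] RegMeas G →L[ℂ] RegMeas G :=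
  pushProd ⟨fun p : G × G => p.1 * p.2, continuous_mul⟩

/-- The left action of `M(G)` on `M(G × H)`: `a · ν = (a ⊗ δ_e) * ν`. -/
noncomputable def leftAct : RegMeas G →L[ℂ] RegMeas (G × H) →L[ℂ] RegMeas (G × H) :=
  (conv (G × H)).comp ((tensor G H).flip (dirac 1))

/-- The right action of `M(H)` on `M(G × H)`, with the algebra element as first argument:
`ν · b = ν * (δ_e ⊗ b)`. -/
noncomputable def rightAct : RegMeas H →L[ℂ] RegMeas (G × H) →L[ℂ] RegMeas (G × H) :=
  (conv (G × H)).flip.comp (tensor G H (dirac 1))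

theorem leftAct_apply (a : RegMeas G) (ν : RegMeas (G × H)) :
    leftAct G H a ν = conv (G × H) (tensor G H a (dirac 1)) ν := rfl

theorem rightAct_apply (b : RegMeas H) (ν : RegMeas (G × H)) :
    rightAct G H b ν = conv (G × H) ν (tensor G H (dirac 1) b) := rfl

end Groups

end RegMeas

end RegMeas

/-! ### Dual Banach algebras and normal, dual Banach bimodules -/

section Bimodules

variable {A B E : Type*} [NormedAddCommGroup A] [NormedSpace ℂ A]
  [NormedAddCommGroup B] [NormedSpace ℂ B] [NormedAddCommGroup E] [NormedSpace ℂ E]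

/-- The bounded bilinear map `m` turns the normed space `A` into a Banach algebra. -/
structure IsBanachAlgebra (m : A →L[ℂ] A →L[ℂ] A) : Prop where
  complete : CompleteSpace A
  assoc : ∀ a b c, m (m a b) c = m a (m b c)
  norm_le : ∀ a b, ‖m a b‖ ≤ ‖a‖ * ‖b‖

/-- The bounded bilinear maps `l a x = a · x` and `r b x = x · b` turn the normed space `E` into a
Banach `A`-`B`-bimodule, where `A` and `B` have the multiplications `mA` and `mB`. -/
structure IsBanachBimodule (mA : A →L[ℂ] A →L[ℂ] A) (mB : B →L[ℂ] B →L[ℂ] B)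
    (l : A →L[ℂ] E →L[ℂ] E) (r : B →L[ℂ] E →L[ℂ] E) : Prop where
  complete : CompleteSpace E
  left_mul : ∀ a a' x, l (mA a a') x = l a (l a' x)
  right_mul : ∀ b b' x, r (mB b b') x = r b' (r b x)
  comm : ∀ a b x, r b (l a x) = l a (r b x)

/-- The Banach `A`-`B`-bimodule `E` is dual with predual `P`: `P` is a closed submodule of the dual
`B`-`A`-bimodule `E^*`, with `(b · φ)(x) = φ (x · b)` and `(φ · a)(x) = φ (a · x)`, and the
canonical map from `E` to the dual of `P` is an isometric isomorphism. -/
structure IsDualBanachBimodule (mA : A →L[ℂ] A →L[ℂ] A) (mB : B →L[ℂ] B →L[ℂ] B)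
    (l : A →L[ℂ] E →L[ℂ] E) (r : B →L[ℂ] E →L[ℂ] E) (P : Submodule ℂ (StrongDual ℂ E)) : Prop
    extends IsBanachBimodule mA mB l r where
  isClosed : IsClosed (P : Set (StrongDual ℂ E))
  left_mem : ∀ b, ∀ p ∈ P, p.comp (r b) ∈ P
  right_mem : ∀ a, ∀ p ∈ P, p.comp (l a) ∈ P
  dual : ∃ e : E ≃ₗᵢ[ℂ] StrongDual ℂ P, ∀ (x : E) (p : P), e x p = p.1 x

/-- The Banach algebra `A` is dual with predual `P`: it is dual as a bimodule over itself. -/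
structure IsDualBanachAlgebra (m : A →L[ℂ] A →L[ℂ] A) (P : Submodule ℂ (StrongDual ℂ A)) : Prop
    extends IsBanachAlgebra m where
  dualBimodule : IsDualBanachBimodule m m m m.flip P

/-- The `w^*`-topology `σ(E, P)`: the coarsest topology on `E` that makes the functionals in `P`
continuous. -/
@[reducible]
noncomputable def weakStar (P : Submodule ℂ (StrongDual ℂ E)) : TopologicalSpace E :=
  TopologicalSpace.induced (fun x (p : P) => p.1 x) inferInstance

/-- `A` and `B` are dual Banach algebras with preduals `PA` and `PB`, and `E` is a normal, dual
Banach `A`-`B`-bimodule with predual `P`. -/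
structure IsNormalDualBanachBimodule (mA : A →L[ℂ] A →L[ℂ] A) (PA : Submodule ℂ (StrongDual ℂ A))
    (mB : B →L[ℂ] B →L[ℂ] B) (PB : Submodule ℂ (StrongDual ℂ B))
    (l : A →L[ℂ] E →L[ℂ] E) (r : B →L[ℂ] E →L[ℂ] E) (P : Submodule ℂ (StrongDual ℂ E)) : Prop
    extends IsDualBanachBimodule mA mB l r P where
  dualLeft : IsDualBanachAlgebra mA PA
  dualRight : IsDualBanachAlgebra mB PB
  normal_left : ∀ x, Continuous[weakStar PA, weakStar P] fun a => l a x
  normal_right : ∀ x, Continuous[weakStar PB, weakStar P] fun b => r b x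

/-- The bounded, separately `w^*`-continuous bilinear forms on `A × B`, with the operator norm
`‖Φ‖ = sup {|Φ(x, y)| : ‖x‖ ≤ 1, ‖y‖ ≤ 1}`. -/
def separatelyWeakStar (PA : Submodule ℂ (StrongDual ℂ A)) (PB : Submodule ℂ (StrongDual ℂ B)) :
    Submodule ℂ (A →L[ℂ] B →L[ℂ] ℂ) where
  carrier := {Φ | (∀ y, Continuous[weakStar PA, inferInstance] fun x => Φ x y) ∧
    ∀ x, Continuous[weakStar PB, inferInstance] fun y => Φ x y}
  add_mem' := fun h h' =>
    ⟨fun y => @Continuous.add ℂ _ _ _ A (weakStar PA) _ _ (h.1 y) (h'.1 y),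
      fun x => @Continuous.add ℂ _ _ _ B (weakStar PB) _ _ (h.2 x) (h'.2 x)⟩
  zero_mem' := ⟨fun _ => @continuous_const A ℂ (weakStar PA) _ 0,
    fun _ => @continuous_const B ℂ (weakStar PB) _ 0⟩
  smul_mem' := fun c _ h =>
    ⟨fun y => @Continuous.comp A ℂ ℂ (weakStar PA) _ _ _ _ (continuous_const_smul c) (h.1 y),
      fun x => @Continuous.comp B ℂ ℂ (weakStar PB) _ _ _ _ (continuous_const_smul c) (h.2 x)⟩

/-- The right action of `A` on bilinear forms, `(Φ · a)(x, y) = Φ (a x, y)`, with the algebra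
element as first argument. -/
noncomputable def formRight (B : Type*) [NormedAddCommGroup B] [NormedSpace ℂ B]
    (mA : A →L[ℂ] A →L[ℂ] A) : A →L[ℂ] (A →L[ℂ] B →L[ℂ] ℂ) →L[ℂ] (A →L[ℂ] B →L[ℂ] ℂ) :=
  (ContinuousLinearMap.compL ℂ A A (B →L[ℂ] ℂ)).flip.comp mA

theorem formRight_apply (mA : A →L[ℂ] A →L[ℂ] A) (a : A) (Φ : A →L[ℂ] B →L[ℂ] ℂ) (x : A) (y : B) :
    formRight B mA a Φ x y = Φ (mA a x) y := rfl

/-- The left action of `B` on bilinear forms, `(b · Φ)(x, y) = Φ (x, y b)`. -/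
noncomputable def formLeft (A : Type*) [NormedAddCommGroup A] [NormedSpace ℂ A]
    (mB : B →L[ℂ] B →L[ℂ] B) : B →L[ℂ] (A →L[ℂ] B →L[ℂ] ℂ) →L[ℂ] (A →L[ℂ] B →L[ℂ] ℂ) :=
  (ContinuousLinearMap.compL ℂ A (B →L[ℂ] ℂ) (B →L[ℂ] ℂ)).comp
    ((ContinuousLinearMap.compL ℂ B B ℂ).flip.comp mB.flip)

theorem formLeft_apply (mB : B →L[ℂ] B →L[ℂ] B) (b : B) (Φ : A →L[ℂ] B →L[ℂ] ℂ) (x : A) (y : B) :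
    formLeft A mB b Φ x y = Φ x (mB y b) := rfl

/-- The action on the dual of a submodule `P` of `E` that is induced by an action `T` on `E` under
which `P` is stable: `(a, ξ) ↦ (p ↦ ξ (T a p))`. -/
noncomputable def dualAction (T : A →L[ℂ] E →L[ℂ] E) (P : Submodule ℂ E)
    (hT : ∀ a, ∀ p ∈ P, T a p ∈ P) : A →L[ℂ] StrongDual ℂ P →L[ℂ] StrongDual ℂ P :=
  (ContinuousLinearMap.compL ℂ P P ℂ).flip.comp
    (LinearMap.mkContinuous₂
      (LinearMap.mk₂ ℂ (fun (a : A) (p : P) => (⟨T a p, hT a p p.2⟩ : P))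
        (fun a a' p => Subtype.ext (by simp))
        (fun c a p => Subtype.ext (by simp))
        (fun a p p' => Subtype.ext (by simp))
        (fun c a p => Subtype.ext (by simp)))
      ‖T‖ fun a p => T.le_opNorm₂ a p)

theorem dualAction_apply (T : A →L[ℂ] E →L[ℂ] E) (P : Submodule ℂ E)
    (hT : ∀ a, ∀ p ∈ P, T a p ∈ P) (a : A) (ξ : StrongDual ℂ P) (p : P) :
    dualAction T P hT a ξ p = ξ ⟨T a p, hT a p p.2⟩ := rfl

end Bimodules

/-! ### Separately `C₀`-functions -/

/-- `SC₀(X × Y)`: the bounded functions `f : X × Y → ℂ` such that `f(x, ·)` belongs to `C₀(Y)` for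
each `x` and `f(·, y)` belongs to `C₀(X)` for each `y`. -/
def SC0 (X Y : Type*) [TopologicalSpace X] [TopologicalSpace Y] : Submodule ℂ (X × Y → ℂ) where
  carrier := {f | (∃ C : ℝ, ∀ p, ‖f p‖ ≤ C) ∧ (∀ x, ∃ g : C₀(Y, ℂ), ∀ y, g y = f (x, y)) ∧
    ∀ y, ∃ g : C₀(X, ℂ), ∀ x, g x = f (x, y)}
  add_mem' := fun {f f'} ⟨⟨C, hC⟩, h1, h2⟩ ⟨⟨C', hC'⟩, h1', h2'⟩ => by
    refine ⟨⟨C + C', fun p => (norm_add_le _ _).trans (add_le_add (hC p) (hC' p))⟩,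
      fun x => ?_, fun y => ?_⟩
    · obtain ⟨g, hg⟩ := h1 x
      obtain ⟨g', hg'⟩ := h1' x
      exact ⟨g + g', fun y => by simp [hg, hg']⟩
    · obtain ⟨g, hg⟩ := h2 y
      obtain ⟨g', hg'⟩ := h2' y
      exact ⟨g + g', fun x => by simp [hg, hg']⟩
  zero_mem' := ⟨⟨0, fun _ => by simp⟩, fun _ => ⟨0, fun _ => rfl⟩, fun _ => ⟨0, fun _ => rfl⟩⟩
  smul_mem' := fun c f ⟨⟨C, hC⟩, h1, h2⟩ => by
    refine ⟨⟨‖c‖ * C, fun p => ?_⟩, fun x => ?_, fun y => ?_⟩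
    · rw [Pi.smul_apply, norm_smul]
      exact mul_le_mul_of_nonneg_left (hC p) (norm_nonneg _)
    · obtain ⟨g, hg⟩ := h1 x
      exact ⟨c • g, fun y => by simp [hg]⟩
    · obtain ⟨g, hg⟩ := h2 y
      exact ⟨c • g, fun x => by simp [hg]⟩

end MeasAlg

open MeasAlg
open scoped ZeroAtInfty

/-!
The statement rests on the Riesz representation theorem and on one fact about separate continuity.

*Riesz representation.* `M(X)` is the dual of `C₀(X)`. A bounded functional `φ` on `C₀(X)` has a
modulus, an additive functional on the nonnegative functions in `C_c(X)`, which is given by a finite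
regular measure `m`. Since `|φ(g)| ≤ ∫ |g| dm`, the functional extends to the Hilbert space `L²(m)`
and is represented there by a density (`exists_regular_measure_eq`). Density of `C_c(X)` in `L¹`
shows that the total variation of a measure is its norm as a functional
(`exists_zeroAtInfty_variation_le`).

*Separate continuity and measurability.* If `f` is bounded and separately `C₀` on `X × Y`, then
`x ↦ f(x, ·)` is a strongly measurable `C₀(Y)`-valued function for every finite regular measure on
`X` (`aestronglyMeasurable_separately`). Two things enter. Over a countable set of parameters `y`
the range of this function is norm separable, by Hahn-Banach, the Riesz representation and dominated
convergence (`exists_countable_cover_on_countable`); and a countable set of parameters determines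
the oscillation almost everywhere on pairs of points, which continuity in `x` turns into a statement
about all pairs of points of a support. Three consequences are drawn:

* the Bochner integral `∫ f(x, ·) dμ(x)` exists in `C₀(Y)` and commutes with functionals, so that
  marginal integrals of `f` are in `C₀` and the order of integration may be interchanged
  (`exists_marginal_integral`, `integral_integral_swap`);
* `f` is measurable for every regular measure on `X × Y` (`integrableFun_of_mem_SC0`);
* `f` may be integrated iteratively against the image of a product measure
  (`integral_pushProd_of_mem_SC0`).

*The modules.* Convolution and both module actions are images of product measures under maps that
tend to infinity in each variable separately. For such a map and `f ∈ C₀`, the composition is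
separately `C₀`. Hence the dual action leaves `C₀` invariant and the action is `w^*`-continuous in
each variable (`comp_pushProd_mem_predual`, `comp_flip_pushProd_mem_predual`), and associativity of
the actions follows from that of the maps by testing against `C₀` (`pushProd_assoc`).

*The forms.* A `w^*`-continuous functional belongs to the predual
(`continuous_weakStar_iff_mem`). Thus a separately `w^*`-continuous form `Φ` is determined by its
kernel `(x, y) ↦ Φ(δ_x, δ_y)`, which is separately `C₀`, and every separately `C₀` function occurs by
the facts on marginal integrals (`apply_eq_integral_integral`, `bijective_formKernel`). Integration
of kernels is isometric on `M(X × Y)` because `C₀(X × Y)` consists of separately `C₀` functions and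
already computes the norm. It respects the actions by iterated integration.
-/

namespace MeasAlg

open MeasureTheory Set Filter Topology TopologicalSpace
open scoped ENNReal NNReal ZeroAtInfty CompactlySupported

/-! ### The modulus of a functional on `C₀(X)` -/

section Modulus

variable {X : Type*} [TopologicalSpace X]

theorem tendsto_zero_of_norm_le {l : Filter X} {f g : X → ℂ}
    (h : ∀ x, ‖f x‖ ≤ ‖g x‖) (hg : Tendsto g l (𝓝 0)) : Tendsto f l (𝓝 0) :=
  squeeze_zero_norm h (by simpa using hg.norm)

theorem norm_apply_le_norm (g : C₀(X, ℂ)) (x : X) : ‖g x‖ ≤ ‖g‖ := g.toBCF.norm_coe_le_norm x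

theorem norm_le_of_forall_le (g : C₀(X, ℂ)) {C : ℝ} (hC : 0 ≤ C) (h : ∀ x, ‖g x‖ ≤ C) : ‖g‖ ≤ C :=
  (BoundedContinuousFunction.norm_le hC (f := g.toBCF)).2 h

/-- The modulus of a functional `φ` on `C₀(X)`: `|φ|(f) = sup {|φ(g)| : |g| ≤ f}` for `f ≥ 0`. It
is taken on `C_c(X, ℝ≥0)`, the domain of the Riesz-Markov-Kakutani theorem. -/
noncomputable def modulus (φ : StrongDual ℂ C₀(X, ℂ)) (f : C_c(X, ℝ≥0)) : ℝ≥0 :=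
  sSup {r | ∃ g : C₀(X, ℂ), (∀ x, ‖g x‖₊ ≤ f x) ∧ ‖φ g‖₊ = r}

variable (φ : StrongDual ℂ C₀(X, ℂ))

theorem bddAbove_modulus (f : C_c(X, ℝ≥0)) :
    BddAbove {r | ∃ g : C₀(X, ℂ), (∀ x, ‖g x‖₊ ≤ f x) ∧ ‖φ g‖₊ = r} := by
  obtain ⟨C, hC⟩ := (f.hasCompactSupport.isCompact_range f.continuous).bddAbove
  refine ⟨‖φ‖₊ * C, ?_⟩
  rintro r ⟨g, hg, rfl⟩
  refine (φ.le_opNNNorm g).trans (mul_le_mul_right ?_ _)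
  exact norm_le_of_forall_le g C.2 fun x => NNReal.coe_le_coe.2 ((hg x).trans (hC ⟨x, rfl⟩))

variable {φ}

theorem le_modulus {f : C_c(X, ℝ≥0)} {g : C₀(X, ℂ)} (h : ∀ x, ‖g x‖₊ ≤ f x) :
    ‖φ g‖₊ ≤ modulus φ f :=
  le_csSup (bddAbove_modulus φ f) ⟨g, h, rfl⟩

theorem modulus_le {f : C_c(X, ℝ≥0)} {c : ℝ≥0}
    (h : ∀ g : C₀(X, ℂ), (∀ x, ‖g x‖₊ ≤ f x) → ‖φ g‖₊ ≤ c) : modulus φ f ≤ c := by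
  refine csSup_le ⟨_, 0, fun x => by simp, rfl⟩ ?_
  rintro r ⟨g, hg, rfl⟩
  exact h g hg

theorem exists_phase (z : ℂ) : ∃ c : ℂ, ‖c‖ ≤ 1 ∧ c * z = ‖z‖ := by
  rcases eq_or_ne z 0 with rfl | hz
  · exact ⟨0, by simp, by simp⟩
  · refine ⟨‖z‖ / z, ?_, by field_simp⟩
    rw [norm_div, Complex.norm_real, norm_norm, div_self (norm_ne_zero_iff.2 hz)]

theorem add_le_modulus_add {f₁ f₂ : C_c(X, ℝ≥0)} {g₁ g₂ : C₀(X, ℂ)} (h₁ : ∀ x, ‖g₁ x‖₊ ≤ f₁ x)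
    (h₂ : ∀ x, ‖g₂ x‖₊ ≤ f₂ x) : ‖φ g₁‖₊ + ‖φ g₂‖₊ ≤ modulus φ (f₁ + f₂) := by
  obtain ⟨c₁, hc₁, e₁⟩ := exists_phase (φ g₁)
  obtain ⟨c₂, hc₂, e₂⟩ := exists_phase (φ g₂)
  have key : ‖φ (c₁ • g₁ + c₂ • g₂)‖₊ ≤ modulus φ (f₁ + f₂) := by
    refine le_modulus fun x => ?_
    have h1 : ‖c₁ * g₁ x‖₊ ≤ f₁ x := by
      rw [nnnorm_mul]; exact (mul_le_of_le_one_left zero_le (show ‖c₁‖₊ ≤ 1 from hc₁)).trans (h₁ x)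
    have h2 : ‖c₂ * g₂ x‖₊ ≤ f₂ x := by
      rw [nnnorm_mul]; exact (mul_le_of_le_one_left zero_le (show ‖c₂‖₊ ≤ 1 from hc₂)).trans (h₂ x)
    exact (nnnorm_add_le _ _).trans (add_le_add h1 h2)
  refine le_trans (le_of_eq ?_) key
  rw [map_add, map_smul, map_smul, smul_eq_mul, smul_eq_mul, e₁, e₂]
  ext
  rw [NNReal.coe_add, coe_nnnorm, coe_nnnorm, coe_nnnorm, ← Complex.ofReal_add, Complex.norm_real,
    Real.norm_of_nonneg (by positivity)]

theorem modulus_mono {f₁ f₂ : C_c(X, ℝ≥0)} (h : ∀ x, f₁ x ≤ f₂ x) :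
    modulus φ f₁ ≤ modulus φ f₂ :=
  modulus_le fun _ hg => le_modulus fun x => (hg x).trans (h x)

/-- Splitting `g` with `|g| ≤ f₁ + f₂` as `g f₁ / (f₁ + f₂) + g f₂ / (f₁ + f₂)` would need an
argument at the zeros of `f₁ + f₂`; adding `ε` to the denominator only costs `ε` in norm. -/
theorem modulus_add_le (f₁ f₂ : C_c(X, ℝ≥0)) :
    modulus φ (f₁ + f₂) ≤ modulus φ f₁ + modulus φ f₂ := by
  refine modulus_le fun g hg => ?_
  refine le_of_forall_pos_le_add fun δ hδ => ?_
  obtain ⟨ε, hε, hεδ⟩ : ∃ ε : ℝ≥0, 0 < ε ∧ ‖φ‖₊ * ε ≤ δ := by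
    refine ⟨δ / (‖φ‖₊ + 1), by positivity, ?_⟩
    rw [mul_div_assoc', div_le_iff₀ (by positivity), mul_comm]
    gcongr
    simp
  have split : ∀ f : C_c(X, ℝ≥0), (∀ x, f x ≤ (f₁ + f₂) x) →
      ∃ k : C₀(X, ℂ), (∀ x, k x = g x * (f x / ((f₁ + f₂) x + ε) : ℝ≥0)) ∧
        ∀ x, ‖k x‖₊ ≤ f x := by
    intro f hf
    have hq : ∀ x, f x / ((f₁ + f₂) x + ε) ≤ 1 := fun x =>
      div_le_one_of_le₀ ((hf x).trans (le_add_of_nonneg_right hε.le)) zero_le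
    have hc : Continuous fun x => g x * ((f x / ((f₁ + f₂) x + ε) : ℝ≥0) : ℂ) := by
      refine g.continuous.mul ?_
      refine Complex.continuous_ofReal.comp (NNReal.continuous_coe.comp ?_)
      exact f.continuous.div ((f₁ + f₂).continuous.add continuous_const) fun x => by positivity
    refine ⟨⟨⟨_, hc⟩, tendsto_zero_of_norm_le (fun x => ?_) (zero_at_infty g)⟩,
      fun x => rfl, fun x => ?_⟩
    · simp only [norm_mul, Complex.norm_real]
      refine mul_le_of_le_one_right (norm_nonneg _) ?_
      rw [Real.norm_of_nonneg (NNReal.coe_nonneg _)]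
      exact hq x
    · change ‖g x * ((f x / ((f₁ + f₂) x + ε) : ℝ≥0) : ℂ)‖₊ ≤ f x
      have e : ‖(((f x / ((f₁ + f₂) x + ε) : ℝ≥0) : ℝ) : ℂ)‖₊ = f x / ((f₁ + f₂) x + ε) := by
        ext; rw [coe_nnnorm, Complex.norm_real, Real.norm_of_nonneg (NNReal.coe_nonneg _)]
      rw [nnnorm_mul, e, mul_div_assoc', div_le_iff₀ (by positivity), mul_comm]
      gcongr
      exact (hg x).trans (le_add_of_nonneg_right hε.le)
  obtain ⟨k₁, e₁, hk₁⟩ := split f₁ fun x => by simp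
  obtain ⟨k₂, e₂, hk₂⟩ := split f₂ fun x => by simp
  have hrest : ‖g - (k₁ + k₂)‖₊ ≤ ε := by
    refine norm_le_of_forall_le _ ε.2 fun x => ?_
    have hpos : (0 : ℝ) < (f₁ x : ℝ) + f₂ x + ε := by positivity
    have hne : ((f₁ x : ℝ) : ℂ) + ((f₂ x : ℝ) : ℂ) + ((ε : ℝ) : ℂ) ≠ 0 := by
      exact_mod_cast hpos.ne'
    have : (g - (k₁ + k₂)) x = g x * (((ε : ℝ) / ((f₁ x : ℝ) + f₂ x + ε) : ℝ) : ℂ) := by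
      simp only [ZeroAtInftyContinuousMap.sub_apply, ZeroAtInftyContinuousMap.add_apply, e₁, e₂]
      push_cast
      simp only [CompactlySupportedContinuousMap.coe_add, Pi.add_apply, NNReal.coe_add,
        Complex.ofReal_add]
      field_simp
      ring
    rw [this, norm_mul, Complex.norm_real, Real.norm_of_nonneg (by positivity), mul_div_assoc',
      div_le_iff₀ hpos, mul_comm]
    have h1 : ‖g x‖ ≤ (f₁ x : ℝ) + f₂ x := by
      have := hg x
      exact_mod_cast this
    exact mul_le_mul_of_nonneg_left (h1.trans (le_add_of_nonneg_right ε.2)) ε.2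
  have h3 : ‖φ (g - (k₁ + k₂))‖₊ ≤ δ :=
    (φ.le_opNNNorm _).trans ((mul_le_mul_right hrest _).trans hεδ)
  have : φ g = φ k₁ + φ k₂ + φ (g - (k₁ + k₂)) := by simp
  rw [this]
  exact (nnnorm_add_le _ _).trans (add_le_add ((nnnorm_add_le _ _).trans
    (add_le_add (le_modulus hk₁) (le_modulus hk₂))) h3)

theorem modulus_add (f₁ f₂ : C_c(X, ℝ≥0)) :
    modulus φ (f₁ + f₂) = modulus φ f₁ + modulus φ f₂ := by
  refine le_antisymm (modulus_add_le f₁ f₂) ?_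
  refine add_le_of_le_tsub_right_of_le (modulus_mono fun x => by simp) ?_
  refine modulus_le fun g₁ h₁ => le_tsub_of_add_le_left ?_
  refine add_le_of_le_tsub_right_of_le ?_ (modulus_le fun g₂ h₂ => le_tsub_of_add_le_right ?_)
  · exact (le_modulus h₁).trans (modulus_mono fun x => by simp)
  · rw [add_comm]
    exact add_le_modulus_add h₁ h₂

theorem mul_modulus_le (c : ℝ≥0) (hc : c ≠ 0) (f : C_c(X, ℝ≥0)) :
    c * modulus φ f ≤ modulus φ (c • f) := by
  rw [mul_comm, ← le_div_iff₀ (pos_iff_ne_zero.2 hc)]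
  refine modulus_le fun g hg => ?_
  rw [le_div_iff₀ (pos_iff_ne_zero.2 hc), mul_comm]
  have e : ‖((c : ℝ) : ℂ)‖₊ = c := by
    ext; rw [coe_nnnorm, Complex.norm_real, Real.norm_of_nonneg (NNReal.coe_nonneg _)]
  have : c * ‖φ g‖₊ = ‖φ (((c : ℝ) : ℂ) • g)‖₊ := by
    rw [map_smul, nnnorm_smul, e]
  rw [this]
  refine le_modulus fun x => ?_
  rw [ZeroAtInftyContinuousMap.smul_apply, nnnorm_smul, e]
  exact mul_le_mul_right (hg x) c

theorem modulus_smul (c : ℝ≥0) (f : C_c(X, ℝ≥0)) : modulus φ (c • f) = c * modulus φ f := by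
  rcases eq_or_ne c 0 with rfl | hc
  · rw [zero_mul, zero_smul]
    refine le_antisymm (modulus_le fun g hg => ?_) zero_le
    have : g = 0 := by
      ext x
      simpa using hg x
    simp [this]
  · refine le_antisymm ?_ (mul_modulus_le c hc f)
    have := mul_modulus_le (φ := φ) c⁻¹ (inv_ne_zero hc) (c • f)
    rw [smul_smul, inv_mul_cancel₀ hc, one_smul] at this
    rwa [inv_mul_le_iff₀ (pos_iff_ne_zero.2 hc)] at this

variable (φ) in
/-- The modulus as a positive linear functional. -/
noncomputable def modulusLinear : C_c(X, ℝ≥0) →ₗ[ℝ≥0] ℝ≥0 where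
  toFun := modulus φ
  map_add' := modulus_add
  map_smul' := modulus_smul

end Modulus

section Riesz

variable {X : Type*} [TopologicalSpace X] [T2Space X] [LocallyCompactSpace X] [MeasurableSpace X]
  [BorelSpace X]

theorem rieszMeasure_modulus_univ_le (φ : StrongDual ℂ C₀(X, ℂ)) :
    NNRealRMK.rieszMeasure (modulusLinear φ) univ ≤ ‖φ‖₊ := by
  rw [isOpen_univ.measure_eq_iSup_isCompact]
  refine iSup₂_le fun K _ => iSup_le fun hK => ?_
  obtain ⟨f, hf1, -, hfc, hf⟩ := exists_continuous_one_zero_of_isCompact hK isClosed_empty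
    (disjoint_empty K)
  let k : C_c(X, ℝ≥0) := ⟨⟨fun x => (f x).toNNReal, by fun_prop⟩,
    hfc.comp_left (g := Real.toNNReal) (by simp)⟩
  have h1 : (NNRealRMK.rieszMeasure (modulusLinear φ)) K ≤
      ∫⁻ x, k x ∂NNRealRMK.rieszMeasure (modulusLinear φ) := by
    rw [← lintegral_indicator_one hK.measurableSet]
    refine lintegral_mono fun x => ?_
    by_cases hx : x ∈ K
    · have : f x = 1 := hf1 hx
      simp [hx, k, this]
    · simp [hx]
  refine h1.trans ?_
  rw [NNRealRMK.lintegral_rieszMeasure]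
  refine ENNReal.coe_le_coe.2 (modulus_le fun g hg => ?_)
  have : ‖g‖ ≤ 1 := norm_le_of_forall_le g zero_le_one fun x => by
    have h2 : ‖g x‖ ≤ (k x : ℝ) := hg x
    refine h2.trans ?_
    change ((f x).toNNReal : ℝ) ≤ 1
    rw [Real.coe_toNNReal _ (hf x).1]
    exact (hf x).2
  exact (φ.le_opNorm g).trans (mul_le_of_le_one_right (norm_nonneg _) this)

instance (φ : StrongDual ℂ C₀(X, ℂ)) :
    IsFiniteMeasure (NNRealRMK.rieszMeasure (modulusLinear φ)) :=
  ⟨(rieszMeasure_modulus_univ_le φ).trans_lt ENNReal.coe_lt_top⟩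

/-- Functions of compact support are dense in `C₀(X)`, with approximants dominated by the given
function. -/
theorem exists_hasCompactSupport_norm_sub_le (g : C₀(X, ℂ)) {ε : ℝ} (hε : 0 < ε) :
    ∃ k : C₀(X, ℂ), HasCompactSupport k ∧ (∀ x, ‖k x‖ ≤ ‖g x‖) ∧ ‖g - k‖ ≤ 2 * ε := by
  -- `u = 0` where `|g| ≤ ε` and `u = 1` where `|g| ≥ 2ε`
  set u : X → ℝ := fun x => min 1 (max 0 (‖g x‖ / ε - 1)) with hu
  have huc : Continuous u := by fun_prop
  have hu0 : ∀ x, 0 ≤ u x := fun x => le_min zero_le_one (le_max_left _ _)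
  have hu1 : ∀ x, u x ≤ 1 := fun x => min_le_left _ _
  have hle : ∀ x, ‖g x * (u x : ℂ)‖ ≤ ‖g x‖ := fun x => by
    rw [norm_mul, Complex.norm_real, Real.norm_of_nonneg (hu0 x)]
    exact mul_le_of_le_one_right (norm_nonneg _) (hu1 x)
  refine ⟨⟨⟨fun x => g x * (u x : ℂ), by fun_prop⟩,
    tendsto_zero_of_norm_le hle (zero_at_infty g)⟩, ?_, hle, ?_⟩
  · have h1 : ∀ᶠ x in cocompact X, ‖g x‖ < ε := by
      have := (zero_at_infty g).norm
      rw [norm_zero] at this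
      exact this.eventually (gt_mem_nhds hε)
    obtain ⟨K, hK, hKsub⟩ := mem_cocompact.1 h1
    refine HasCompactSupport.intro hK fun x hx => ?_
    have h2 : ‖g x‖ < ε := hKsub hx
    have : u x = 0 := by
      have : ‖g x‖ / ε - 1 ≤ 0 := by
        rw [sub_nonpos, div_le_one hε]; exact h2.le
      simp [hu, max_eq_left this]
    change g x * (u x : ℂ) = 0
    simp [this]
  · refine norm_le_of_forall_le _ (by positivity) fun x => ?_
    change ‖g x - g x * (u x : ℂ)‖ ≤ 2 * ε
    by_cases h : ‖g x‖ ≤ 2 * ε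
    · have : g x - g x * (u x : ℂ) = g x * ((1 - u x : ℝ) : ℂ) := by push_cast; ring
      rw [this, norm_mul, Complex.norm_real, Real.norm_of_nonneg (by linarith [hu1 x])]
      exact (mul_le_of_le_one_right (norm_nonneg _) (by linarith [hu0 x])).trans h
    · have : u x = 1 := by
        have h3 : 2 ≤ ‖g x‖ / ε := by rw [le_div_iff₀ hε]; exact (not_le.1 h).le
        have : 1 ≤ ‖g x‖ / ε - 1 := by linarith
        simp [hu, this]
      simp [this, hε.le]

/-- A functional is dominated by the measure of its modulus. On `C_c(X)` this is the definition of
the modulus, applied to `|g|`. -/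
theorem norm_le_integral_rieszMeasure_modulus (φ : StrongDual ℂ C₀(X, ℂ)) (g : C₀(X, ℂ)) :
    ‖φ g‖ ≤ ∫ x, ‖g x‖ ∂NNRealRMK.rieszMeasure (modulusLinear φ) := by
  set m := NNRealRMK.rieszMeasure (modulusLinear φ) with hm
  have hint : ∀ k : C₀(X, ℂ), Integrable (fun x => ‖k x‖) m := fun k =>
    (Integrable.of_bound k.continuous.measurable.aestronglyMeasurable ‖k‖
      (.of_forall (norm_apply_le_norm k))).norm
  refine le_of_forall_pos_le_add fun δ hδ => ?_
  set ε : ℝ := δ / (2 * (‖φ‖ + 1)) with hε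
  have hε0 : 0 < ε := by positivity
  obtain ⟨k, hkc, hkg, hgk⟩ := exists_hasCompactSupport_norm_sub_le g hε0
  have h1 : ‖φ k‖ ≤ ∫ x, ‖k x‖ ∂m := by
    let f : C_c(X, ℝ≥0) := ⟨⟨fun x => ‖k x‖₊, by fun_prop⟩, hkc.comp_left (g := fun z => ‖z‖₊)
      (by simp)⟩
    have h2 : ‖φ k‖₊ ≤ modulusLinear φ f := le_modulus fun x => le_rfl
    have h3 := NNRealRMK.integral_rieszMeasure (modulusLinear φ) f
    have h4 : ∫ x, ‖k x‖ ∂m = modulusLinear φ f := h3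
    rw [h4]
    exact h2
  have h2 : ‖φ (g - k)‖ ≤ δ := by
    refine (φ.le_opNorm _).trans ?_
    have : ‖φ‖ * (2 * ε) ≤ δ := by
      rw [hε]
      have : 0 ≤ ‖φ‖ := norm_nonneg _
      field_simp
      linarith
    exact (mul_le_mul_of_nonneg_left hgk (norm_nonneg _)).trans this
  have h3 : ∫ x, ‖k x‖ ∂m ≤ ∫ x, ‖g x‖ ∂m := integral_mono (hint k) (hint g) hkg
  have : φ g = φ k + φ (g - k) := by simp
  rw [this]
  exact (norm_add_le _ _).trans (add_le_add (h1.trans h3) h2)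

end Riesz

/-! ### The Riesz representation theorem -/

section ComplexIntegral

variable {X : Type*} {mX : MeasurableSpace X}

/-- The integral `∫ f dμ` of a complex function against a complex measure. -/
noncomputable abbrev cint (μ : VectorMeasure X ℂ) (f : X → ℂ) : ℂ :=
  μ.integral f (ContinuousLinearMap.mul ℝ ℂ)

theorem cint_indicator_const (μ : VectorMeasure X ℂ) (c : ℂ) {s : Set X} (hs : MeasurableSet s) :
    cint μ (s.indicator fun _ => c) = c * μ s := by
  have := isFiniteMeasure_variation μ
  rw [cint, VectorMeasure.integral_indicator_const _ hs]
  simp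

theorem norm_cint_le_integral (μ : VectorMeasure X ℂ) (f : X → ℂ) :
    ‖cint μ f‖ ≤ ∫ x, ‖f x‖ ∂μ.variation := by
  refine VectorMeasure.norm_integral_le_integral_norm.trans ?_
  exact mul_le_of_le_one_left (integral_nonneg fun _ => norm_nonneg _)
    (ContinuousLinearMap.opNorm_mul_le ℝ ℂ)

theorem integrable_of_norm_le (m : Measure X) [IsFiniteMeasure m] {f : X → ℂ} (hf : Measurable f)
    {C : ℝ} (hC : ∀ x, ‖f x‖ ≤ C) : Integrable f m :=
  Integrable.of_bound hf.aestronglyMeasurable C (.of_forall hC)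

/-- A property of bounded measurable functions holds for all of them if it holds for multiples of
indicator functions and is stable under sums and bounded pointwise limits of sequences. -/
theorem bounded_measurable_induction {P : (X → ℂ) → Prop}
    (ind : ∀ (c : ℂ) (s : Set X), MeasurableSet s → P (s.indicator fun _ => c))
    (add : ∀ f g : X → ℂ, Measurable f → Measurable g → (∃ C, ∀ x, ‖f x‖ ≤ C) →
      (∃ C, ∀ x, ‖g x‖ ≤ C) → P f → P g → P (f + g))
    (lim : ∀ (F : ℕ → X → ℂ) (f : X → ℂ) (C : ℝ), (∀ n, Measurable (F n)) →
      (∀ n x, ‖F n x‖ ≤ C) → (∀ x, Tendsto (fun n => F n x) atTop (𝓝 (f x))) →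
      (∀ n, P (F n)) → P f)
    {f : X → ℂ} (hf : Measurable f) {C : ℝ} (hC : ∀ x, ‖f x‖ ≤ C) : P f := by
  have simple : ∀ s : SimpleFunc X ℂ, P s := fun s => by
    refine SimpleFunc.induction (motive := fun s => P s) (fun c s hs => ?_)
      (fun s t _ hs ht => ?_) s
    · simpa [SimpleFunc.coe_piecewise, Function.const_def] using! ind c s hs
    · exact add s t s.measurable t.measurable s.exists_forall_norm_le t.exists_forall_norm_le hs ht
  have hsm : StronglyMeasurable f := hf.stronglyMeasurable
  rcases isEmpty_or_nonempty X with hX | ⟨⟨x₀⟩⟩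
  · have : f = ((0 : SimpleFunc X ℂ) : X → ℂ) := Subsingleton.elim _ _
    rw [this]
    exact simple 0
  · have hC0 : 0 ≤ C := (norm_nonneg _).trans (hC x₀)
    exact lim (fun n => hsm.approxBounded C n) f C (fun n => (hsm.approxBounded C n).measurable)
      (fun n x => hsm.norm_approxBounded_le hC0 n x)
      (fun x => hsm.tendsto_approxBounded_of_norm_le (hC x)) fun n => simple _

/-- Integration against `h dm`. The density need not be bounded, so `f` is taken bounded. -/
theorem cint_withDensityᵥ {m : Measure X} {h : X → ℂ} (hh : Integrable h m)
    {f : X → ℂ} (hf : Measurable f) {C : ℝ} (hC : ∀ x, ‖f x‖ ≤ C) :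
    cint (m.withDensityᵥ h) f = ∫ x, f x * h x ∂m := by
  set μ := m.withDensityᵥ h with hμ
  have := isFiniteMeasure_variation μ
  have hint : ∀ f : X → ℂ, Measurable f → (∃ C, ∀ x, ‖f x‖ ≤ C) →
      Integrable (fun x => f x * h x) m := fun f hf ⟨C, hC⟩ =>
    hh.bdd_mul hf.aestronglyMeasurable (.of_forall hC)
  refine bounded_measurable_induction (P := fun f => cint μ f = ∫ x, f x * h x ∂m) ?_ ?_ ?_ hf hC
  · intro c s hs
    rw [cint_indicator_const μ c hs, hμ, withDensityᵥ_apply hh hs, ← integral_const_mul,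
      ← integral_indicator hs]
    congr 1
    ext x
    by_cases hx : x ∈ s <;> simp [hx]
  · rintro f g hf hg ⟨C, hC⟩ ⟨D, hD⟩ h1 h2
    rw [cint, VectorMeasure.integral_add (integrable_of_norm_le _ hf hC)
      (integrable_of_norm_le _ hg hD), ← cint, ← cint, h1, h2,
      ← integral_add (hint f hf ⟨C, hC⟩) (hint g hg ⟨D, hD⟩)]
    simp [add_mul]
  · intro F f C hF hC hlim hP
    refine tendsto_nhds_unique
      (VectorMeasure.tendsto_integral_filter_of_norm_le_const
        (.of_forall fun n => (hF n).aestronglyMeasurable)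
        ⟨C, .of_forall fun n => .of_forall (hC n)⟩ (.of_forall hlim)) ?_
    change Tendsto (fun n => cint μ (F n)) atTop _
    simp_rw [hP]
    refine tendsto_integral_of_dominated_convergence (fun x => C * ‖h x‖)
      (fun n => ((hF n).aestronglyMeasurable.mul hh.1)) (hh.norm.const_mul C)
      (fun n => .of_forall fun x => ?_) (.of_forall fun x => (hlim x).mul_const _)
    rw [norm_mul]
    exact mul_le_mul_of_nonneg_right (hC n x) (norm_nonneg _)

end ComplexIntegral

section Riesz

variable {X : Type*} [TopologicalSpace X] [T2Space X] [LocallyCompactSpace X] [MeasurableSpace X]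
  [BorelSpace X]

theorem regular_withDensity (m : Measure X) [IsFiniteMeasure m] [m.Regular] {h : X → ℝ≥0∞}
    (hh : ∫⁻ x, h x ∂m ≠ ∞) : (m.withDensity h).Regular := by
  have hfin : IsFiniteMeasure (m.withDensity h) := isFiniteMeasure_withDensity hh
  have : (m.withDensity h).InnerRegular := by
    refine ⟨fun E hE r hr => ?_⟩
    obtain ⟨s, hs, hs'⟩ := exists_between hr
    obtain ⟨δ, hδ, hδ'⟩ := exists_pos_setLIntegral_lt_of_measure_lt hh (tsub_pos_of_lt hs).ne'
    obtain ⟨K, hKE, hK, hlt⟩ := hE.exists_isCompact_sdiff_lt (measure_ne_top m E) hδ.ne'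
    refine ⟨K, hKE, hK, ?_⟩
    have h1 : m.withDensity h E ≤ m.withDensity h K + m.withDensity h (E \ K) := by
      refine (measure_mono ?_).trans (measure_union_le K (E \ K))
      simp
    have h2 : m.withDensity h (E \ K) ≤ s - r := by
      rw [withDensity_apply _ (MeasurableSet.diff hE hK.measurableSet)]
      exact (hδ' _ hlt).le
    by_contra hcon
    push Not at hcon
    have h3 : m.withDensity h E ≤ r + (s - r) := h1.trans (add_le_add hcon h2)
    rw [add_tsub_cancel_of_le hs.le] at h3
    exact absurd hs' (not_lt.mpr h3)
  infer_instance

/-- Density of `C_c(X)` in `Lᵖ(m)` for a finite regular measure `m` on a locally compact Hausdorff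
space, which need not be normal. -/
theorem exists_hasCompactSupport_eLpNorm_sub_le (m : Measure X) [IsFiniteMeasure m] [m.Regular]
    {p : ℝ≥0∞} (hp : p ≠ ∞) {f : X → ℂ} (hf : MemLp f p m) {ε : ℝ≥0∞} (hε : ε ≠ 0) :
    ∃ g : X → ℂ, eLpNorm (f - g) p m ≤ ε ∧ Continuous g ∧ MemLp g p m ∧ HasCompactSupport g := by
  refine hf.induction_dense hp
    (P := fun g => Continuous g ∧ MemLp g p m ∧ HasCompactSupport g) ?_ ?_ ?_ hε
  · intro c t ht _ ε hε
    obtain ⟨η, hη0, hη⟩ := exists_eLpNorm_indicator_le (μ := m) hp c hε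
    have hη2 : (η : ℝ≥0∞) / 2 ≠ 0 := by simp [hη0.ne']
    obtain ⟨K, hKt, hK, hKη⟩ := ht.exists_isCompact_sdiff_lt (measure_ne_top m t) hη2
    obtain ⟨V, htV, hV, -, hVη⟩ := ht.exists_isOpen_sdiff_lt (measure_ne_top m t) hη2
    obtain ⟨u, hu1, hu0, huc, hu⟩ := exists_continuous_one_zero_of_isCompact hK hV.isClosed_compl
      (disjoint_compl_right_iff_subset.2 (hKt.trans htV))
    have hcont : Continuous fun x => (u x : ℂ) * c := by fun_prop
    have hcs : HasCompactSupport fun x => (u x : ℂ) * c :=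
      huc.comp_left (g := fun r : ℝ => (r : ℂ) * c) (by simp)
    refine ⟨fun x => (u x : ℂ) * c, ?_, hcont, hcont.memLp_of_hasCompactSupport hcs, hcs⟩
    refine le_trans (eLpNorm_mono (g := (V \ K).indicator fun _ => c) fun x => ?_) (hη (V \ K) ?_)
    · have hux : ‖(u x : ℂ) * c‖ ≤ ‖c‖ := by
        rw [norm_mul, Complex.norm_real, Real.norm_of_nonneg (hu x).1]
        exact mul_le_of_le_one_left (norm_nonneg _) (hu x).2
      have hux' : ‖(u x : ℂ) * c - c‖ ≤ ‖c‖ := by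
        have : (u x : ℂ) * c - c = ((u x - 1 : ℝ) : ℂ) * c := by push_cast; ring
        rw [this, norm_mul, Complex.norm_real, Real.norm_eq_abs]
        refine mul_le_of_le_one_left (norm_nonneg _) (abs_le.2 ⟨?_, ?_⟩) <;>
          linarith [(hu x).1, (hu x).2]
      simp only [Pi.sub_apply]
      by_cases hxK : x ∈ K
      · have : u x = 1 := hu1 hxK
        simp [hKt hxK, hxK, this]
      · by_cases hxV : x ∈ V
        · rw [indicator_of_mem (show x ∈ V \ K from ⟨hxV, hxK⟩)]
          by_cases hxt : x ∈ t
          · simpa [hxt] using hux'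
          · simpa [hxt] using hux
        · have : u x = 0 := hu0 hxV
          simp [hxV, this, show x ∉ t from fun h => hxV (htV h)]
    · calc m (V \ K) ≤ m (V \ t) + m (t \ K) := by
            refine (measure_mono fun x hx => ?_).trans (measure_union_le _ _)
            by_cases hxt : x ∈ t
            · exact Or.inr ⟨hxt, hx.2⟩
            · exact Or.inl ⟨hx.1, hxt⟩
        _ ≤ η / 2 + η / 2 := add_le_add hVη.le hKη.le
        _ = η := ENNReal.add_halves _
  · rintro f g ⟨f1, f2, f3⟩ ⟨g1, g2, g3⟩
    exact ⟨f1.add g1, f2.add g2, f3.add g3⟩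
  · exact fun f hf => hf.2.1.1

theorem measurable_zeroAtInfty (g : C₀(X, ℂ)) : Measurable g := g.continuous.measurable

/-- Riesz representation. The modulus of `φ` is a finite regular measure `m` with
`|φ(g)| ≤ ∫ |g| dm`, so that `φ` extends to the Hilbert space `L²(m)`, where it is represented by a
density with respect to `m`. -/
theorem exists_regular_measure_eq (φ : StrongDual ℂ C₀(X, ℂ)) :
    ∃ μ : VectorMeasure X ℂ, μ.variation.Regular ∧ ∀ g : C₀(X, ℂ), φ g = cint μ g := by
  set m := NNRealRMK.rieszMeasure (modulusLinear φ) with hm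
  let e : C₀(X, ℂ) →ₗ[ℂ] Lp ℂ 2 m :=
    { toFun := fun g => BoundedContinuousFunction.toLp 2 m ℂ g.toBCF
      map_add' := fun f g => by rw [← map_add]; rfl
      map_smul' := fun c g => by rw [RingHom.id_apply, ← map_smul]; rfl }
  have he : ∀ g, e g =ᵐ[m] g := fun g => BoundedContinuousFunction.coeFn_toLp 2 m ℂ g.toBCF
  have hdense : DenseRange e := by
    intro f
    rw [mem_closure_iff_nhds_basis Metric.nhds_basis_eball]
    intro ε hε
    obtain ⟨ε', hε'0, hε'⟩ := exists_between hε
    obtain ⟨g, hg, hgcont, hgm, hgc⟩ := exists_hasCompactSupport_eLpNorm_sub_le m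
      (by simp) (Lp.memLp f) hε'0.ne'
    refine ⟨e ⟨⟨g, hgcont⟩, hgc.is_zero_at_infty⟩, ⟨_, rfl⟩, ?_⟩
    rw [Metric.mem_eball, edist_comm, Lp.edist_def]
    refine lt_of_le_of_lt (le_of_eq ?_) (hg.trans_lt hε')
    refine eLpNorm_congr_ae ?_
    filter_upwards [he ⟨⟨g, hgcont⟩, hgc.is_zero_at_infty⟩] with x hx
    simp only [Pi.sub_apply, hx]
    rfl
  have hnorm : ∃ C, ∀ g, ‖(φ : C₀(X, ℂ) →ₗ[ℂ] ℂ) g‖ ≤ C * ‖e g‖ := by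
    refine ⟨((m univ) ^ (1 / (1 : ℝ≥0∞).toReal - 1 / (2 : ℝ≥0∞).toReal)).toReal, fun g => ?_⟩
    refine (norm_le_integral_rieszMeasure_modulus φ g).trans ?_
    have h1 : eLpNorm (e g) 1 m ≤ eLpNorm (e g) 2 m *
        (m univ) ^ (1 / (1 : ℝ≥0∞).toReal - 1 / (2 : ℝ≥0∞).toReal) :=
      eLpNorm_le_eLpNorm_mul_rpow_measure_univ (by norm_num) (Lp.aestronglyMeasurable _)
    have hfin : eLpNorm (e g) 2 m * (m univ) ^ (1 / (1 : ℝ≥0∞).toReal - 1 / (2 : ℝ≥0∞).toReal)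
        ≠ ∞ := by
      refine ENNReal.mul_ne_top (Lp.eLpNorm_ne_top _) ?_
      exact ENNReal.rpow_ne_top_of_nonneg (by norm_num) (measure_ne_top _ _)
    have h2 := ENNReal.toReal_mono hfin h1
    rw [ENNReal.toReal_mul, ← Lp.norm_def, mul_comm] at h2
    refine le_trans (le_of_eq ?_) h2
    rw [eLpNorm_one_eq_lintegral_enorm, ← integral_norm_eq_lintegral_enorm
      (Lp.aestronglyMeasurable _)]
    refine integral_congr_ae ?_
    filter_upwards [he g] with x hx
    rw [hx]
  let Φ : StrongDual ℂ (Lp ℂ 2 m) := (φ : C₀(X, ℂ) →ₗ[ℂ] ℂ).extendOfNorm e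
  have hΦ : ∀ g, Φ (e g) = φ g := fun g => LinearMap.extendOfNorm_eq hdense hnorm g
  set k := (InnerProductSpace.toDual ℂ (Lp ℂ 2 m)).symm Φ with hk
  -- the inner product of `L²(m)` is conjugate linear in its first argument
  set h : X → ℂ := fun x => starRingEnd ℂ (k x) with hh
  have hkint : Integrable k m := (Lp.memLp k).integrable (by norm_num)
  have hint : Integrable h m := by
    refine ⟨Complex.continuous_conj.comp_aestronglyMeasurable hkint.1, ?_⟩
    refine hkint.2.congr' (.of_forall fun x => by simp [hh])
  refine ⟨m.withDensityᵥ h, ?_, fun g => ?_⟩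
  · rw [Measure.variation_withDensityᵥ hint]
    exact regular_withDensity m hint.2.ne
  · rw [cint_withDensityᵥ hint (measurable_zeroAtInfty g) (norm_apply_le_norm g), ← hΦ,
      ← InnerProductSpace.toDual_symm_apply (𝕜 := ℂ), L2.inner_def]
    refine integral_congr_ae ?_
    filter_upwards [he g] with x hx
    rw [hx]
    simp [hh, hk]

/-- Truncation to the unit disc at most doubles the distance to a point of the disc. -/
theorem norm_div_max_sub_le (w z : ℂ) (hw : ‖w‖ ≤ 1) :
    ‖w - z / (max 1 ‖z‖ : ℝ)‖ ≤ 2 * ‖w - z‖ := by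
  have h1 : ‖z - z / (max 1 ‖z‖ : ℝ)‖ ≤ ‖w - z‖ := by
    rcases le_total ‖z‖ 1 with h | h
    · simp [max_eq_left h]
    · have h0 : (‖z‖ : ℂ) ≠ 0 := by
        have : (0 : ℝ) < ‖z‖ := by linarith
        exact_mod_cast this.ne'
      have : z - z / (‖z‖ : ℝ) = z / (‖z‖ : ℝ) * ((‖z‖ - 1 : ℝ) : ℂ) := by
        push_cast
        field_simp
      rw [max_eq_right h, this, norm_mul, norm_div, Complex.norm_real, Complex.norm_real,
        norm_norm, div_self (by linarith), one_mul, Real.norm_of_nonneg (by linarith)]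
      have := norm_sub_norm_le z w
      rw [norm_sub_rev] at this
      linarith
  calc _ = ‖(w - z) + (z - z / (max 1 ‖z‖ : ℝ))‖ := by ring_nf
    _ ≤ _ := norm_add_le _ _
    _ ≤ _ := by linarith

/-- The total variation of a regular complex measure is attained, up to `ε`, on the unit ball of
`C₀(X)`. -/
theorem exists_zeroAtInfty_variation_le (μ : VectorMeasure X ℂ) (hμ : μ.variation.Regular) {ε : ℝ}
    (hε : 0 < ε) : ∃ f : C₀(X, ℂ), ‖f‖ ≤ 1 ∧ (μ.variation univ).toReal ≤ ‖cint μ f‖ + ε := by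
  classical
  have := isFiniteMeasure_variation μ
  obtain ⟨P, -, hPd, hPm, hP⟩ := μ.exists_variation_le_add MeasurableSet.univ
    (ε := (ε / 3).toNNReal) (by simpa using hε) (measure_ne_top _ _)
  -- `w` is the simple function that has on each part `p` the phase of `μ p`
  choose c hc hce using fun p : Set X => exists_phase (μ p)
  set w : X → ℂ := fun x => ∑ p ∈ P, p.indicator (fun _ => c p) x with hw
  have hwm : Measurable w := Finset.measurable_sum _ fun p hp =>
    measurable_const.indicator (hPm p hp)
  have hw1 : ∀ x, ‖w x‖ ≤ 1 := by
    intro x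
    by_cases hx : ∃ p ∈ P, x ∈ p
    · obtain ⟨p, hp, hxp⟩ := hx
      have : w x = c p := by
        rw [hw]
        change ∑ p ∈ P, p.indicator (fun _ => c p) x = c p
        rw [Finset.sum_eq_single p]
        · simp [hxp]
        · intro q hq hqp
          refine indicator_of_notMem (fun hxq => ?_) _
          exact Set.disjoint_left.1 (hPd hq hp hqp) hxq hxp
        · exact fun h => absurd hp h
      rw [this]
      exact hc p
    · push Not at hx
      have : w x = 0 := Finset.sum_eq_zero fun p hp => indicator_of_notMem (hx p hp) _
      simp [this]
  have hwint := integrable_of_norm_le μ.variation hwm hw1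
  have hcw : cint μ w = ((∑ p ∈ P, ‖μ p‖ : ℝ) : ℂ) := by
    rw [cint, hw, VectorMeasure.integral_finsetSum P fun p hp =>
      integrable_of_norm_le (C := 1) _ (measurable_const.indicator (hPm p hp)) fun x =>
        (norm_indicator_le_norm_self _ _).trans (hc p)]
    rw [Complex.ofReal_sum]
    refine Finset.sum_congr rfl fun p hp => ?_
    rw [← hce p]
    exact cint_indicator_const μ (c p) (hPm p hp)
  have hsum : (μ.variation univ).toReal ≤ ‖cint μ w‖ + ε / 3 := by
    have h1 := ENNReal.toReal_mono (by simp) hP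
    rw [ENNReal.toReal_add (by simp) (by simp), ENNReal.toReal_sum (by simp)] at h1
    rw [hcw, Complex.norm_real, Real.norm_of_nonneg (Finset.sum_nonneg fun _ _ => norm_nonneg _)]
    refine h1.trans (le_of_eq ?_)
    simp only [toReal_enorm, ENNReal.coe_toReal, Real.coe_toNNReal _ (div_nonneg hε.le zero_le_three)]
  obtain ⟨g, hg, hgcont, hgm, hgc⟩ := exists_hasCompactSupport_eLpNorm_sub_le μ.variation
    ENNReal.one_ne_top (memLp_one_iff_integrable.2 hwint)
    (ε := ENNReal.ofReal (ε / 3)) (by simpa using hε)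
  have hgint : Integrable g μ.variation := memLp_one_iff_integrable.1 hgm
  replace hg : ∫ x, ‖w x - g x‖ ∂μ.variation ≤ ε / 3 := by
    rw [eLpNorm_one_eq_lintegral_enorm] at hg
    change ∫ x, ‖(w - g) x‖ ∂μ.variation ≤ ε / 3
    rw [integral_norm_eq_lintegral_enorm (hwint.sub hgint).1]
    exact ENNReal.toReal_le_of_le_ofReal (by positivity) hg
  -- the truncation of `g` to the unit disc
  set k : X → ℂ := fun x => g x / (max 1 ‖g x‖ : ℝ) with hk
  have hpos : ∀ x, (0 : ℝ) < max 1 ‖g x‖ := fun x => lt_max_of_lt_left one_pos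
  have hkcont : Continuous k := hgcont.div (by fun_prop) fun x => by exact_mod_cast (hpos x).ne'
  have hk1 : ∀ x, ‖k x‖ ≤ 1 := fun x => by
    rw [hk, norm_div, Complex.norm_real, Real.norm_of_nonneg (hpos x).le]
    exact div_le_one_of_le₀ (le_max_right _ _) (hpos x).le
  have hkc : HasCompactSupport k := hgc.mono fun x hx => by
    contrapose! hx
    have : g x = 0 := by simpa using hx
    simp [hk, this]
  refine ⟨⟨⟨k, hkcont⟩, hkc.is_zero_at_infty⟩, norm_le_of_forall_le _ zero_le_one hk1, ?_⟩
  change _ ≤ ‖cint μ k‖ + ε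
  have hkint := integrable_of_norm_le μ.variation hkcont.measurable hk1
  have hdiff : ‖cint μ w - cint μ k‖ ≤ 2 * (ε / 3) := by
    rw [cint, cint, ← VectorMeasure.integral_fun_sub hwint hkint]
    refine (norm_cint_le_integral μ _).trans ?_
    refine le_trans ?_ (mul_le_mul_of_nonneg_left hg zero_le_two)
    rw [← integral_const_mul]
    exact integral_mono (hwint.sub hkint).norm ((hwint.sub hgint).norm.const_mul 2) fun x =>
      norm_div_max_sub_le (w x) (g x) (hw1 x)
  have := norm_sub_norm_le (cint μ w) (cint μ k)
  linarith

end Riesz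

/-! ### Measurability of separately `C₀` functions -/

section Measurability

/-- A function that for each `ε` oscillates by at most `ε` on each of countably many measurable sets
covering almost everything is a limit of countably valued measurable functions. -/
theorem aestronglyMeasurable_of_countable_cover {X E : Type*} [MeasurableSpace X]
    [PseudoMetricSpace E] {m : Measure X} {F : X → E}
    (h : ∀ ε : ℝ, 0 < ε → ∃ A : ℕ → Set X, (∀ n, MeasurableSet (A n)) ∧ m (⋃ n, A n)ᶜ = 0 ∧
      ∀ n, ∀ x ∈ A n, ∀ x' ∈ A n, dist (F x) (F x') ≤ ε) :
    AEStronglyMeasurable F m := by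
  classical
  rcases isEmpty_or_nonempty X with hX | ⟨⟨x₀⟩⟩
  · exact (StronglyMeasurable.of_subsingleton_dom).aestronglyMeasurable
  choose A hAm hA0 hAd using fun k : ℕ => h (1 / (k + 1)) (by positivity)
  have hex : ∀ k x, ∃ n, x ∈ A k n ∨ x ∈ (⋃ n, A k n)ᶜ := fun k x => by
    by_cases hx : x ∈ ⋃ n, A k n
    · obtain ⟨n, hn⟩ := mem_iUnion.1 hx
      exact ⟨n, Or.inl hn⟩
    · exact ⟨0, Or.inr hx⟩
  let v : ℕ → ℕ → E := fun k n => if hn : (A k n).Nonempty then F hn.some else F x₀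
  let G : ℕ → X → E := fun k x => v k (Nat.find (hex k x))
  have hG : ∀ k, StronglyMeasurable (G k) := fun k => by
    have h1 : Measurable fun x => Nat.find (hex k x) := measurable_find _ fun n =>
      (hAm k n).union (MeasurableSet.iUnion (hAm k)).compl
    have h2 : StronglyMeasurable (v k) := StronglyMeasurable.of_discrete
    exact h2.comp_measurable h1
  refine aestronglyMeasurable_of_tendsto_ae atTop (fun k => (hG k).aestronglyMeasurable) ?_
  have hae : ∀ᵐ x ∂m, ∀ k, x ∈ ⋃ n, A k n := ae_all_iff.2 fun k => hA0 k
  filter_upwards [hae] with x hx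
  rw [tendsto_iff_dist_tendsto_zero]
  refine squeeze_zero (fun _ => dist_nonneg) (fun k => ?_) tendsto_one_div_add_atTop_nhds_zero_nat
  have hmem : x ∈ A k (Nat.find (hex k x)) :=
    (Nat.find_spec (hex k x)).resolve_right fun h => h (hx k)
  have hne : (A k (Nat.find (hex k x))).Nonempty := ⟨x, hmem⟩
  have : G k x = F hne.some := dif_pos hne
  rw [this]
  exact hAd k _ _ hne.some_mem _ hmem

/-- Among uniformly bounded measurable functions on a finite measure space there are countably many
whose supremum is an essential upper bound of all of them. -/
theorem exists_countable_iSup_ae_le {Ω ι : Type*} [MeasurableSpace Ω] (P : Measure Ω)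
    [IsFiniteMeasure P] (h : ι → Ω → ℝ≥0∞) (hm : ∀ i, Measurable (h i)) (C : ℝ≥0∞) (hC : C ≠ ∞)
    (hb : ∀ i ω, h i ω ≤ C) :
    ∃ S : Set ι, S.Countable ∧ ∀ i, ∀ᵐ ω ∂P, h i ω ≤ ⨆ s ∈ S, h s ω := by
  let φ : Set ι → ℝ≥0∞ := fun S => ∫⁻ ω, ⨆ s ∈ S, h s ω ∂P
  have hmono : ∀ S T : Set ι, S ⊆ T → φ S ≤ φ T := fun S T hST =>
    lintegral_mono fun ω => biSup_mono hST
  -- the union of a maximizing sequence of countable sets attains the largest integral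
  obtain ⟨u, -, hu, huS⟩ := exists_seq_tendsto_sSup (S := φ '' {S | S.Countable})
    ⟨_, ∅, countable_empty, rfl⟩ (OrderTop.bddAbove _)
  choose S hS hSu using huS
  have hScount : (⋃ n, S n).Countable := countable_iUnion hS
  refine ⟨⋃ n, S n, hScount, fun i => ?_⟩
  have hmax : φ (insert i (⋃ n, S n)) ≤ φ (⋃ n, S n) := by
    have h1 : φ (insert i (⋃ n, S n)) ≤ sSup (φ '' {S | S.Countable}) :=
      le_sSup ⟨_, hScount.insert i, rfl⟩
    refine h1.trans (le_of_tendsto hu (.of_forall fun n => ?_))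
    rw [← hSu n]
    exact hmono _ _ (subset_iUnion S n)
  have hmeas : ∀ T : Set ι, T.Countable → Measurable fun ω => ⨆ s ∈ T, h s ω := fun T hT =>
    Measurable.biSup T hT fun s _ => hm s
  have hfin : φ (⋃ n, S n) ≠ ∞ := by
    refine ((lintegral_mono fun ω => iSup₂_le fun s _ => hb s ω).trans_lt ?_).ne
    rw [lintegral_const]
    exact ENNReal.mul_lt_top hC.lt_top (measure_lt_top _ _)
  have hae := ae_eq_of_ae_le_of_lintegral_le (μ := P)
    (f := fun ω => ⨆ s ∈ ⋃ n, S n, h s ω) (g := fun ω => ⨆ s ∈ insert i (⋃ n, S n), h s ω)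
    (.of_forall fun ω => biSup_mono (subset_insert i _)) hfin
    (hmeas _ (hScount.insert i)).aemeasurable hmax
  filter_upwards [hae] with ω hω
  rw [hω]
  exact le_biSup (fun s => h s ω) (mem_insert i _)

variable {X Y : Type*} [TopologicalSpace X] [TopologicalSpace Y]

theorem exists_le_nhds_or_le_cocompact (U : Ultrafilter X) :
    (∃ x, (U : Filter X) ≤ 𝓝 x) ∨ (U : Filter X) ≤ cocompact X := by
  by_cases h : ∃ x, (U : Filter X) ≤ 𝓝 x
  · exact Or.inl h
  · refine Or.inr fun s hs => ?_
    obtain ⟨K, hK, hKs⟩ := mem_cocompact.1 hs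
    refine mem_of_superset ?_ hKs
    refine Ultrafilter.compl_mem_iff_notMem.2 fun hKU => h ?_
    obtain ⟨x, -, hx⟩ := hK.ultrafilter_le_nhds U (le_principal_iff.2 hKU)
    exact ⟨x, hx⟩

/-- A separately `C₀` function, seen as a family of functions in `C₀(Y)`. Convergence of a net of
such functions on a set passes to its closure: along ultrafilters the index points converge in the
one-point compactification of `X`. -/
theorem tendsto_apply_of_mem_closure {F : X → C₀(Y, ℂ)}
    (hF : ∀ y, ∃ g : C₀(X, ℂ), ∀ x, g x = F x y) {S : Set Y} {ι : Type*} {l : Filter ι} {d : ι → X}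
    {x : X} (h : ∀ s ∈ S, Tendsto (fun i => F (d i) s) l (𝓝 (F x s))) {y : Y}
    (hy : y ∈ closure S) : Tendsto (fun i => F (d i) y) l (𝓝 (F x y)) := by
  rw [tendsto_iff_ultrafilter]
  intro U hU
  choose g hg using hF
  simp_rw [← hg]
  simp_rw [← hg] at h
  have key : ∀ k : Y → ℂ, Continuous k → (∀ y, Tendsto (fun i => g y (d i)) U (𝓝 (k y))) →
      k y = g y x := by
    intro k hk hlim
    have hc : Continuous fun y => g y x := by simp_rw [hg]; exact (F x).continuous
    refine closure_minimal (s := S) (t := {y | k y = g y x}) (fun s hs => ?_)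
      (isClosed_eq hk hc) hy
    exact tendsto_nhds_unique (hlim s) ((h s hs).mono_left hU)
  -- the index points converge to a point `z` of `X` or to infinity; the two continuous functions
  -- `F x` and `F z`, or `F x` and `0`, then agree on `S` and hence on its closure
  rcases exists_le_nhds_or_le_cocompact (U.map d) with ⟨z, hz⟩ | hz
  · have hlim : ∀ y, Tendsto (fun i => g y (d i)) U (𝓝 (g y z)) := fun y =>
      ((g y).continuous.tendsto z).comp hz
    have hc : Continuous fun y => g y z := by simp_rw [hg]; exact (F z).continuous
    rw [← key (fun y => g y z) hc hlim]
    exact hlim y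
  · have hlim : ∀ y, Tendsto (fun i => g y (d i)) U (𝓝 0) := fun y =>
      (zero_at_infty (g y)).comp hz
    rw [← key 0 continuous_zero hlim]
    exact hlim y

variable [T2Space Y] [LocallyCompactSpace Y]

/-- A bounded separately `C₀` family is norm separable over a countable set of parameters: with `D`
countable such that every `F x` is a pointwise limit on `S` of a sequence in `F '' D`, dominated
convergence and the Riesz representation put `F x` into the norm-closed span of `F '' D` over
`closure S`. -/
theorem exists_countable_cover_on_countable {F : X → C₀(Y, ℂ)}
    (hF : ∀ y, ∃ g : C₀(X, ℂ), ∀ x, g x = F x y) {C : ℝ} (hC : ∀ x, ‖F x‖ ≤ C) {S : Set Y}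
    (hS : S.Countable) {ε : ℝ} (hε : 0 < ε) :
    ∃ D : Set X, D.Countable ∧ ∀ x, ∃ d ∈ D, ∀ s ∈ S, ‖F x s - F d s‖ ≤ ε := by
  letI : MeasurableSpace (closure S) := borel _
  haveI : BorelSpace (closure S) := ⟨rfl⟩
  have hT : IsClosed (closure S) := isClosed_closure
  haveI : LocallyCompactSpace (closure S) := hT.locallyCompactSpace
  let G : X → C₀(closure S, ℂ) := fun x => (F x).comp
    ⟨⟨Subtype.val, continuous_subtype_val⟩, hT.isClosedEmbedding_subtypeVal.tendsto_cocompact⟩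
  have hGF : ∀ x (t : closure S), G x t = F x t := fun x t => rfl
  -- a countable set dense for pointwise convergence on `S`
  haveI : Countable S := hS.to_subtype
  let q : X → S → ℂ := fun x s => F x s
  obtain ⟨t, htq, htc, hqt⟩ :=
    (IsSeparable.of_separableSpace (range q)).exists_countable_dense_subset
  obtain ⟨p, hp⟩ : ∃ p : t → X, ∀ a, q (p a) = a := ⟨fun a => (htq a.2).choose, fun a =>
    (htq a.2).choose_spec⟩
  haveI : Countable t := htc.to_subtype
  let W : Submodule ℂ C₀(closure S, ℂ) :=
    (Submodule.span ℂ (G '' range p)).topologicalClosure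
  have hWsep : IsSeparable (W : Set C₀(closure S, ℂ)) := by
    rw [Submodule.topologicalClosure_coe]
    exact (((countable_range p).image G).isSeparable.span).closure
  have hGW : ∀ x, G x ∈ W := by
    intro x
    by_contra hx
    -- a functional separating `G x` from `W` is a measure, which dominated convergence refutes
    haveI : IsClosed (W : Set C₀(closure S, ℂ)) := Submodule.isClosed_topologicalClosure _
    have hne : ‖W.mkQ (G x)‖ ≠ 0 := by
      rw [norm_ne_zero_iff]
      simpa using hx
    obtain ⟨ψ, -, hψ⟩ := exists_dual_vector ℂ (W.mkQ (G x)) hne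
    obtain ⟨μ, -, hμ⟩ := exists_regular_measure_eq (ψ.comp W.mkQL)
    have hzero : ∀ a, cint μ (G (p a)) = 0 := fun a => by
      rw [← hμ]
      have : G (p a) ∈ W :=
        Submodule.le_topologicalClosure _ (Submodule.subset_span ⟨_, ⟨a, rfl⟩, rfl⟩)
      have h0 : W.mkQL (G (p a)) = 0 := (Submodule.Quotient.mk_eq_zero W).2 this
      rw [ContinuousLinearMap.comp_apply, h0, map_zero]
    obtain ⟨a, hat, ha⟩ := mem_closure_iff_seq_limit.1 (hqt ⟨x, rfl⟩)
    have hlim : ∀ y : closure S, Tendsto (fun n => G (p ⟨a n, hat n⟩) y) atTop (𝓝 (G x y)) := by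
      intro y
      refine tendsto_apply_of_mem_closure hF (fun s hs => ?_) y.2
      have := (tendsto_pi_nhds.1 ha) ⟨s, hs⟩
      refine this.congr fun n => ?_
      exact (congrFun (hp ⟨a n, hat n⟩) ⟨s, hs⟩).symm
    have := isFiniteMeasure_variation μ
    have h1 : Tendsto (fun n => cint μ (G (p ⟨a n, hat n⟩))) atTop (𝓝 (cint μ (G x))) :=
      VectorMeasure.tendsto_integral_filter_of_norm_le_const
        (.of_forall fun n => (measurable_zeroAtInfty _).aestronglyMeasurable)
        ⟨C, .of_forall fun n => .of_forall fun y =>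
          (norm_apply_le_norm (F (p ⟨a n, hat n⟩)) y).trans (hC _)⟩ (.of_forall hlim)
    simp_rw [hzero] at h1
    have h2 : cint μ (G x) = 0 := tendsto_nhds_unique h1 tendsto_const_nhds
    rw [← hμ] at h2
    refine hne ?_
    have h3 : ψ (W.mkQ (G x)) = 0 := h2
    rw [h3] at hψ
    simpa using hψ.symm
  have hsep : IsSeparable (range G) := hWsep.mono (range_subset_iff.2 hGW)
  obtain ⟨t', ht', htc', hGt'⟩ := hsep.exists_countable_dense_subset
  choose p' hp' using fun a : t' => ht' a.2
  haveI : Countable t' := htc'.to_subtype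
  refine ⟨range p', countable_range p', fun x => ?_⟩
  obtain ⟨k, hk, hkε⟩ := Metric.mem_closure_iff.1 (hGt' ⟨x, rfl⟩) ε hε
  refine ⟨p' ⟨k, hk⟩, ⟨_, rfl⟩, fun s hs => ?_⟩
  have h1 : ‖(G x - k) ⟨s, subset_closure hs⟩‖ ≤ ‖G x - k‖ := norm_apply_le_norm _ _
  rw [← dist_eq_norm] at h1
  refine le_trans (le_of_eq ?_) (h1.trans hkε.le)
  have : k = G (p' ⟨k, hk⟩) := (hp' ⟨k, hk⟩).symm
  conv_rhs => rw [this]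
  rfl

variable [T2Space X] [LocallyCompactSpace X] [MeasurableSpace X] [BorelSpace X]

/-- Almost every point of `A` is in the support of the restriction of `m` to `A`. -/
theorem measure_sdiff_support_eq_zero (m : Measure X) [IsFiniteMeasure m] [m.Regular] (A : Set X) :
    ∃ N : Set X, IsOpen N ∧ m (A ∩ N) = 0 ∧ ∀ x ∉ N, ∀ U ∈ 𝓝 x, m (U ∩ A) ≠ 0 := by
  let N : Set X := ⋃₀ {U | IsOpen U ∧ m (U ∩ A) = 0}
  have hN : IsOpen N := isOpen_sUnion fun U hU => hU.1
  refine ⟨N, hN, ?_, fun x hx U hU h0 => ?_⟩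
  · have hr : (m.restrict A).InnerRegular := inferInstance
    rw [inter_comm, ← Measure.restrict_apply hN.measurableSet, hN.measure_eq_iSup_isCompact]
    refine le_antisymm (iSup₂_le fun K hKN => iSup_le fun hK => ?_) zero_le
    refine le_of_eq (hK.measure_zero_of_nhdsWithin fun x hx => ?_)
    obtain ⟨U, ⟨hU, hU0⟩, hxU⟩ := hKN hx
    refine ⟨U, mem_nhdsWithin_of_mem_nhds (hU.mem_nhds hxU), ?_⟩
    rwa [Measure.restrict_apply hU.measurableSet]
  · obtain ⟨V, hVU, hV, hxV⟩ := mem_nhds_iff.1 hU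
    refine hx ⟨V, ⟨hV, ?_⟩, hxV⟩
    exact measure_mono_null (inter_subset_inter_left A hVU) h0

/-- Johnson's theorem on separate continuity and measurability, in vector-valued form: a bounded
separately `C₀` function is a strongly measurable `C₀(Y)`-valued function for every finite regular
measure `m` on `X`. A countable set `S` of parameters determines the oscillation of `F` almost
everywhere for `m × m`; for each `y`, continuity in `x` upgrades this to every pair of points in the
support of the restriction of `m` to a set on which `F` oscillates little over `S`. -/
theorem aestronglyMeasurable_separately {F : X → C₀(Y, ℂ)}
    (hF : ∀ y, ∃ g : C₀(X, ℂ), ∀ x, g x = F x y) {C : ℝ} (hC : ∀ x, ‖F x‖ ≤ C)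
    (m : Measure X) [IsFiniteMeasure m] [m.Regular] : AEStronglyMeasurable F m := by
  have hFc : ∀ y, Continuous fun x => F x y := fun y => by
    obtain ⟨g, hg⟩ := hF y
    simp_rw [← hg]
    exact g.continuous
  obtain ⟨S, hS, hSae⟩ := exists_countable_iSup_ae_le (m.prod m)
    (fun (y : Y) (z : X × X) => ‖F z.1 y - F z.2 y‖ₑ)
    (fun y => (((hFc y).measurable.comp measurable_fst).sub
      ((hFc y).measurable.comp measurable_snd)).enorm)
    (ENNReal.ofReal (C + C)) ENNReal.ofReal_ne_top (fun y z => by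
      rw [← ofReal_norm]
      refine ENNReal.ofReal_le_ofReal ((norm_sub_le _ _).trans (add_le_add ?_ ?_)) <;>
        exact (norm_apply_le_norm _ _).trans (hC _))
  refine aestronglyMeasurable_of_countable_cover fun ε hε => ?_
  rcases isEmpty_or_nonempty X with hX | ⟨⟨x₀⟩⟩
  · exact ⟨fun _ => ∅, fun _ => .empty, by simp [eq_empty_of_isEmpty], by simp⟩
  obtain ⟨D, hD, hDx⟩ := exists_countable_cover_on_countable hF hC hS (half_pos hε)
  obtain ⟨d, hd⟩ := hD.exists_eq_range (by obtain ⟨d, hd, -⟩ := hDx x₀; exact ⟨d, hd⟩)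
  -- over `S`, the function `F` oscillates by at most `ε` on each `A n`
  let A : ℕ → Set X := fun n => ⋂ s ∈ S, {x | ‖F x s - F (d n) s‖ ≤ ε / 2}
  have hAm : ∀ n, MeasurableSet (A n) := fun n =>
    MeasurableSet.biInter hS fun s _ => (isClosed_le (by have := hFc s; fun_prop)
      continuous_const).measurableSet
  choose N hN hN0 hNpos using fun n => measure_sdiff_support_eq_zero m (A n)
  refine ⟨fun n => A n \ N n, fun n => (hAm n).diff (hN n).measurableSet, ?_, ?_⟩
  · refine measure_mono_null (t := ⋃ n, A n ∩ N n) (fun x hx => ?_) (measure_iUnion_null hN0)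
    obtain ⟨c, hc, hcx⟩ := hDx x
    rw [hd] at hc
    obtain ⟨n, rfl⟩ := hc
    have hxA : x ∈ A n := mem_iInter₂.2 hcx
    refine mem_iUnion.2 ⟨n, hxA, ?_⟩
    by_contra hxN
    exact hx (mem_iUnion.2 ⟨n, hxA, hxN⟩)
  · intro n x hx x' hx'
    rw [dist_eq_norm]
    refine norm_le_of_forall_le _ hε.le fun y => ?_
    by_contra hlt
    have hlt : ε < ‖F x y - F x' y‖ := not_le.1 hlt
    have hopen : IsOpen {z : X × X | ε < ‖F z.1 y - F z.2 y‖} :=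
      isOpen_lt continuous_const (by have := hFc y; fun_prop)
    obtain ⟨U, V, hU, hV, hxU, hxV, hUV⟩ := isOpen_prod_iff.1 hopen x x' hlt
    have h1 := hNpos n x hx.2 U (hU.mem_nhds hxU)
    have h2 := hNpos n x' hx'.2 V (hV.mem_nhds hxV)
    -- a rectangle of positive measure on which the oscillation at `y` exceeds that over `S`
    have h3 : (m.prod m) ((U ∩ A n) ×ˢ (V ∩ A n)) ≠ 0 := by
      rw [Measure.prod_prod]
      exact mul_ne_zero h1 h2
    refine h3 (measure_mono_null (fun z hz => ?_) (hSae y))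
    change ¬ (‖F z.1 y - F z.2 y‖ₑ ≤ ⨆ s ∈ S, ‖F z.1 s - F z.2 s‖ₑ)
    rw [not_le]
    have hz1 : ε < ‖F z.1 y - F z.2 y‖ := hUV ⟨hz.1.1, hz.2.1⟩
    refine lt_of_le_of_lt (b := ENNReal.ofReal ε) (iSup₂_le fun s hs => ?_) ?_
    · rw [← ofReal_norm]
      refine ENNReal.ofReal_le_ofReal ?_
      have e1 := mem_iInter₂.1 hz.1.2 s hs
      have e2 := mem_iInter₂.1 hz.2.2 s hs
      simp only [mem_ofPred_eq] at e1 e2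
      rw [norm_sub_rev] at e2
      calc ‖F z.1 s - F z.2 s‖ = ‖(F z.1 s - F (d n) s) + (F (d n) s - F z.2 s)‖ := by ring_nf
        _ ≤ _ := norm_add_le _ _
        _ ≤ ε := by linarith
    · rw [← ofReal_norm]
      exact (ENNReal.ofReal_lt_ofReal_iff (hε.trans hz1)).2 hz1

end Measurability

/-! ### Iterated integrals -/

section Fubini

/-- An integrable vector-valued function has an integral against a complex measure, and the integral
commutes with bounded functionals. -/
theorem exists_forall_apply_eq_cint {X E : Type*} {mX : MeasurableSpace X}
    [NormedAddCommGroup E] [NormedSpace ℂ E] [CompleteSpace E] (μ : VectorMeasure X ℂ) {F : X → E}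
    (hF : Integrable F μ.variation) :
    ∃ e : E, ∀ T : StrongDual ℂ E, T e = cint μ fun x => T (F x) := by
  have := isFiniteMeasure_variation μ
  let B : E →L[ℝ] ℂ →L[ℝ] E := (ContinuousLinearMap.lsmul ℝ ℂ).flip
  refine ⟨μ.integral F B, fun T => ?_⟩
  have hT : ∀ {F : X → E}, Integrable F μ.variation →
      Integrable (fun x => T (F x)) μ.variation := fun h => T.integrable_comp h
  refine Integrable.induction (μ := μ.variation)
    (fun F : X → E => T (μ.integral F B) = cint μ fun x => T (F x)) ?_ ?_ ?_ ?_ hF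
  · intro c s hs _
    have h1 : (fun x => T (s.indicator (fun _ => c) x)) = s.indicator fun _ => T c := by
      ext x
      by_cases hx : x ∈ s <;> simp [hx]
    rw [h1, cint_indicator_const μ _ hs, VectorMeasure.integral_indicator_const _ hs]
    simp [B, mul_comm]
  · intro f g _ hf hg h1 h2
    rw [VectorMeasure.integral_add hf hg, map_add, h1, h2, cint, cint,
      ← VectorMeasure.integral_add (hT hf) (hT hg)]
    congr 1
    ext x
    simp
  · refine IsSeqClosed.isClosed fun F f hF hFf => ?_
    have h0 : Tendsto (fun n => ∫⁻ x, ‖F n x - f x‖ₑ ∂μ.variation) atTop (𝓝 0) := by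
      have := (tendsto_iff_edist_tendsto_0).1 hFf
      refine this.congr fun n => ?_
      rw [Lp.edist_def, eLpNorm_one_eq_lintegral_enorm]
      rfl
    have h1 := VectorMeasure.tendsto_integral_of_L1 (μ := μ) (B := B) f
      (Lp.aestronglyMeasurable f) (.of_forall fun n => L1.integrable_coeFn (F n)) h0
    have h2 : Tendsto (fun n => cint μ fun x => T (F n x)) atTop
        (𝓝 (cint μ fun x => T (f x))) := VectorMeasure.tendsto_integral_of_L1 _
      (hT (L1.integrable_coeFn f)).aestronglyMeasurable
      (.of_forall fun n => hT (L1.integrable_coeFn (F n))) (by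
        refine tendsto_of_tendsto_of_tendsto_of_le_of_le tendsto_const_nhds
          (by simpa using ENNReal.Tendsto.const_mul (a := ‖T‖ₑ) h0 (Or.inr enorm_ne_top))
          (fun _ => zero_le) fun n => ?_
        rw [← lintegral_const_mul' _ _ enorm_ne_top]
        refine lintegral_mono fun x => ?_
        rw [← map_sub]
        exact T.le_opENorm _)
    exact tendsto_nhds_unique ((T.continuous.tendsto _).comp h1) (h2.congr fun n => (hF n).symm)
  · intro f g hfg _ h
    rw [← VectorMeasure.integral_congr_ae hfg, h]
    exact VectorMeasure.integral_congr_ae (hfg.mono fun x hx => congrArg T hx)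

variable {X Y Z : Type*}
  [TopologicalSpace X] [T2Space X] [LocallyCompactSpace X] [MeasurableSpace X] [BorelSpace X]
  [TopologicalSpace Y] [T2Space Y] [LocallyCompactSpace Y] [MeasurableSpace Y] [BorelSpace Y]
  [TopologicalSpace Z] [T2Space Z] [MeasurableSpace Z] [BorelSpace Z]

/-- A separately `C₀` function is measurable for every finite regular measure on `X × Y`. The
statement is about the pair of coordinate maps, since the Borel σ-algebra of `X × Y` may be larger
than the product σ-algebra. -/
theorem aestronglyMeasurable_comp_separately {F : X → C₀(Y, ℂ)}
    (hF : ∀ y, ∃ g : C₀(X, ℂ), ∀ x, g x = F x y) {C : ℝ} (hC : ∀ x, ‖F x‖ ≤ C) {p : Z → X}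
    {q : Z → Y} (hp : Continuous p) (hq : Continuous q) (m : Measure Z) [IsFiniteMeasure m]
    [m.Regular] : AEStronglyMeasurable (fun z => F (p z) (q z)) m := by
  have : (m.map p).InnerRegular := Measure.InnerRegular.map_of_continuous hp
  have h1 : AEStronglyMeasurable F (m.map p) := aestronglyMeasurable_separately hF hC _
  have h2 : AEStronglyMeasurable (fun z => F (p z)) m := h1.comp_measurable hp.measurable
  refine aestronglyMeasurable_of_tendsto_ae atTop
    (f := fun n z => h2.stronglyMeasurable_mk.approx n z (q z)) (fun n => ?_) ?_
  · refine Measurable.aestronglyMeasurable ?_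
    exact (h2.stronglyMeasurable_mk.approx n).measurable_bind (fun g z => g (q z))
      fun g => (g.continuous.comp hq).measurable
  · filter_upwards [h2.ae_eq_mk] with z hz
    have h3 := h2.stronglyMeasurable_mk.tendsto_approx z
    rw [← hz] at h3
    rw [tendsto_iff_norm_sub_tendsto_zero] at h3 ⊢
    exact squeeze_zero (fun _ => norm_nonneg _)
      (fun n => norm_apply_le_norm (h2.stronglyMeasurable_mk.approx n z - F (p z)) (q z)) h3

/-- Integration against the image under `φ` of a product measure is iterated integration. -/
theorem cint_pushVectorMeasure_of_measurable {φ : X → Y → Z}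
    (hφ : Continuous (Function.uncurry φ)) (μ : VectorMeasure X ℂ) (hμ : μ.variation.Regular)
    (ν : VectorMeasure Y ℂ) {g : Z → ℂ} (hg : Measurable g) {C : ℝ} (hC : ∀ z, ‖g z‖ ≤ C) :
    Measurable (fun y => cint μ fun x => g (φ x y)) ∧
      cint (pushVectorMeasure hφ μ hμ ν) g = cint ν fun y => cint μ fun x => g (φ x y) := by
  have := isFiniteMeasure_variation μ
  have := isFiniteMeasure_variation ν
  have := isFiniteMeasure_variation (pushVectorMeasure hφ μ hμ ν)
  have hm : ∀ y, Measurable fun x => φ x y := fun y =>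
    (hφ.comp (Continuous.prodMk_left y)).measurable
  have hbd : ∀ {g : Z → ℂ} {C : ℝ}, (∀ z, ‖g z‖ ≤ C) → ∀ y,
      ‖cint μ fun x => g (φ x y)‖ ≤ C * μ.variation.real univ := fun {g C} h y =>
    (norm_cint_le_integral _ _).trans (by
      refine (le_abs_self _).trans ?_
      rw [← Real.norm_eq_abs]
      exact norm_integral_le_of_norm_le_const (.of_forall fun x => by
        rw [norm_norm]; exact h _))
  refine bounded_measurable_induction (P := fun g =>
    Measurable (fun y => cint μ fun x => g (φ x y)) ∧
      cint (pushVectorMeasure hφ μ hμ ν) g = cint ν fun y => cint μ fun x => g (φ x y))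
    ?_ ?_ ?_ hg hC
  · intro c s hs
    have h1 : (fun y => cint μ fun x => s.indicator (fun _ => c) (φ x y)) =
        fun y => c * μ {x | φ x y ∈ s} := by
      ext y
      rw [← cint_indicator_const μ c (measurableSet_section hφ hs y)]
      rfl
    rw [h1, cint_indicator_const _ c hs, pushVectorMeasure_apply hφ μ hμ ν hs, cint,
      integral_const_smul]
    exact ⟨(measurable_section_complex hφ μ hμ hs).const_mul c, rfl⟩
  · rintro f g hf hg ⟨C, hC⟩ ⟨C', hC'⟩ ⟨hf1, hf2⟩ ⟨hg1, hg2⟩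
    have h1 : (fun y => cint μ fun x => (f + g) (φ x y)) =
        (fun y => cint μ fun x => f (φ x y)) + fun y => cint μ fun x => g (φ x y) := by
      ext y
      exact VectorMeasure.integral_fun_add (integrable_of_norm_le _ (hf.comp (hm y)) fun _ => hC _)
        (integrable_of_norm_le _ (hg.comp (hm y)) fun _ => hC' _)
    rw [h1]
    refine ⟨hf1.add hg1, ?_⟩
    rw [cint, VectorMeasure.integral_add (integrable_of_norm_le _ hf hC)
      (integrable_of_norm_le _ hg hC')]
    rw [cint, VectorMeasure.integral_add (integrable_of_norm_le _ hf1 (hbd hC))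
      (integrable_of_norm_le _ hg1 (hbd hC'))]
    exact congrArg₂ (· + ·) hf2 hg2
  · intro F f C hF hC hlim hP
    have h1 : ∀ y, Tendsto (fun n => cint μ fun x => F n (φ x y)) atTop
        (𝓝 (cint μ fun x => f (φ x y))) := fun y =>
      VectorMeasure.tendsto_integral_filter_of_norm_le_const
        (.of_forall fun n => ((hF n).comp (hm y)).aestronglyMeasurable)
        ⟨C, .of_forall fun n => .of_forall fun x => hC n _⟩ (.of_forall fun x => hlim _)
    refine ⟨measurable_of_tendsto_metrizable (fun n => (hP n).1) (tendsto_pi_nhds.2 h1), ?_⟩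
    refine tendsto_nhds_unique (VectorMeasure.tendsto_integral_filter_of_norm_le_const
      (.of_forall fun n => (hF n).aestronglyMeasurable)
      ⟨C, .of_forall fun n => .of_forall (hC n)⟩ (.of_forall hlim)) ?_
    have h2 : Tendsto (fun n => cint ν fun y => cint μ fun x => F n (φ x y)) atTop
        (𝓝 (cint ν fun y => cint μ fun x => f (φ x y))) :=
      VectorMeasure.tendsto_integral_filter_of_norm_le_const
        (.of_forall fun n => (hP n).1.aestronglyMeasurable)
        ⟨_, .of_forall fun n => .of_forall fun y => hbd (hC n) y⟩ (.of_forall h1)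
    exact h2.congr fun n => (hP n).2.symm

/-- Iterated integration for functions that are measurable with respect to the image of the product
of the total variation measures. -/
theorem cint_pushVectorMeasure {φ : X → Y → Z}
    (hφ : Continuous (Function.uncurry φ)) (μ : VectorMeasure X ℂ) (hμ : μ.variation.Regular)
    (ν : VectorMeasure Y ℂ) {g : Z → ℂ}
    (hg : AEStronglyMeasurable g (pushMeasure φ μ.variation ν.variation)) {C : ℝ}
    (hC : ∀ z, ‖g z‖ ≤ C) :
    cint (pushVectorMeasure hφ μ hμ ν) g = cint ν fun y => cint μ fun x => g (φ x y) := by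
  have := isFiniteMeasure_variation μ
  have hmk : Measurable (hg.mk g) := hg.stronglyMeasurable_mk.measurable
  -- a Borel modification of `g` that is bounded everywhere
  let g' : Z → ℂ := {z | ‖hg.mk g z‖ ≤ C}.indicator (hg.mk g)
  have hg' : Measurable g' := hmk.indicator (measurableSet_le hmk.norm measurable_const)
  have hC' : ∀ z, ‖g' z‖ ≤ max C 0 := fun z => by
    by_cases hz : ‖hg.mk g z‖ ≤ C
    · rw [show g' z = hg.mk g z from indicator_of_mem (s := {z | ‖hg.mk g z‖ ≤ C}) hz _]
      exact hz.trans (le_max_left _ _)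
    · rw [show g' z = 0 from indicator_of_notMem (s := {z | ‖hg.mk g z‖ ≤ C}) hz _, norm_zero]
      exact le_max_right _ _
  have hae : g =ᵐ[pushMeasure φ μ.variation ν.variation] g' := by
    filter_upwards [hg.ae_eq_mk] with z hz
    rw [show g' z = hg.mk g z from indicator_of_mem (by
      change ‖_‖ ≤ C
      rw [← hz]
      exact hC z) _, hz]
  have h1 : cint (pushVectorMeasure hφ μ hμ ν) g = cint (pushVectorMeasure hφ μ hμ ν) g' :=
    VectorMeasure.integral_congr_ae
      (hae.filter_mono (ae_mono (variation_pushVectorMeasure_le hφ μ hμ ν)))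
  have h2 : ∀ᵐ y ∂ν.variation, ∀ᵐ x ∂μ.variation, g (φ x y) = g' (φ x y) := by
    have hN := measurableSet_toMeasurable (pushMeasure φ μ.variation ν.variation)
      {z | ¬ g z = g' z}
    have h0 : pushMeasure φ μ.variation ν.variation
        (toMeasurable (pushMeasure φ μ.variation ν.variation) {z | ¬ g z = g' z}) = 0 := by
      rw [measure_toMeasurable]
      exact hae
    rw [pushMeasure_apply hφ _ _ hN,
      lintegral_eq_zero_iff (measurable_section_measure hφ _ hN)] at h0
    filter_upwards [h0] with y hy
    exact measure_mono_null
      (fun x hx => subset_toMeasurable (pushMeasure φ μ.variation ν.variation) _ hx) hy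
  rw [h1, (cint_pushVectorMeasure_of_measurable hφ μ hμ ν hg' hC').2]
  exact VectorMeasure.integral_congr_ae (h2.mono fun y hy =>
    VectorMeasure.integral_congr_ae (hy.mono fun x hx => hx.symm))

end Fubini

/-! ### Duality of `M(X)` and `C₀(X)` -/

namespace RegMeas

section Duality

variable {X : Type*} [TopologicalSpace X] [T2Space X]

theorem integral_dirac (x : X) (f : X → ℂ) : (dirac x).integral f = f x := by
  letI : MeasurableSpace X := borel X
  haveI : BorelSpace X := ⟨rfl⟩
  have h : (VectorMeasure.dirac x (1 : ℂ)).integral f (ContinuousLinearMap.mul ℝ ℂ) = f x := by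
    simp
  exact h

theorem norm_dirac (x : X) : ‖dirac x‖ = 1 := by
  letI : MeasurableSpace X := borel X
  haveI : BorelSpace X := ⟨rfl⟩
  change ((VectorMeasure.dirac x (1 : ℂ)).variation univ).toReal = 1
  rw [VectorMeasure.variation_dirac]
  simp

/-- `C₀(X)` embeds isometrically into the dual of `M(X)`: point masses attain the supremum norm. -/
theorem norm_pairing (f : C₀(X, ℂ)) : ‖pairing X f‖ = ‖f‖ := by
  refine le_antisymm (ContinuousLinearMap.opNorm_le_bound _ (norm_nonneg _) fun μ =>
    μ.norm_integral_le f ‖f‖ (norm_nonneg _) (norm_apply_le_norm f)) ?_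
  refine norm_le_of_forall_le f (norm_nonneg _) fun x => ?_
  have h := (pairing X f).le_opNorm (dirac x)
  rwa [norm_dirac, mul_one, pairing_apply, integral_dirac] at h

theorem isClosed_predual : IsClosed (predual X : Set (StrongDual ℂ (RegMeas X))) := by
  have h : Isometry (pairing X) := AddMonoidHomClass.isometry_of_norm _ norm_pairing
  exact h.isClosedEmbedding.isClosed_range

theorem pairing_mem_predual (f : C₀(X, ℂ)) : pairing X f ∈ predual X := ⟨f, rfl⟩

variable [LocallyCompactSpace X]

theorem exists_norm_le_norm_integral_add (μ : RegMeas X) {ε : ℝ} (hε : 0 < ε) :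
    ∃ f : C₀(X, ℂ), ‖f‖ ≤ 1 ∧ ‖μ‖ ≤ ‖μ.integral f‖ + ε := by
  letI : MeasurableSpace X := borel X
  haveI : BorelSpace X := ⟨rfl⟩
  exact exists_zeroAtInfty_variation_le μ.toMeas μ.regular_tv hε

theorem exists_forall_eq_integral (φ : StrongDual ℂ C₀(X, ℂ)) :
    ∃ μ : RegMeas X, ∀ g : C₀(X, ℂ), φ g = μ.integral g := by
  letI : MeasurableSpace X := borel X
  haveI : BorelSpace X := ⟨rfl⟩
  obtain ⟨μ, hμ, h⟩ := exists_regular_measure_eq φ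
  exact ⟨⟨μ, hμ⟩, h⟩

/-- `M(X)` is the dual space of `C₀(X)`. -/
theorem exists_linearIsometryEquiv_dual_predual :
    ∃ e : RegMeas X ≃ₗᵢ[ℂ] StrongDual ℂ (predual X), ∀ (μ : RegMeas X) (p : predual X),
      e μ p = p.1 μ := by
  let e₀ : RegMeas X →L[ℂ] StrongDual ℂ (predual X) := (predual X).subtypeL.flip
  have he : ∀ μ p, e₀ μ p = p.1 μ := fun _ _ => rfl
  have hnorm : ∀ μ, ‖e₀ μ‖ = ‖μ‖ := by
    intro μ
    refine le_antisymm (ContinuousLinearMap.opNorm_le_bound _ (norm_nonneg _) fun p => ?_) ?_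
    · rw [he, mul_comm]
      exact p.1.le_opNorm μ
    · refine le_of_forall_pos_le_add fun ε hε => ?_
      obtain ⟨f, hf, hle⟩ := exists_norm_le_norm_integral_add μ hε
      refine hle.trans (add_le_add_left ?_ ε)
      have h := (e₀ μ).le_opNorm ⟨pairing X f, pairing_mem_predual f⟩
      refine h.trans (mul_le_of_le_one_right (norm_nonneg _) ?_)
      exact (norm_pairing f).trans_le hf
  let e₁ : RegMeas X →ₗᵢ[ℂ] StrongDual ℂ (predual X) := ⟨e₀.toLinearMap, hnorm⟩
  refine ⟨LinearIsometryEquiv.ofSurjective e₁ fun ξ => ?_, fun μ p => rfl⟩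
  let J : C₀(X, ℂ) →L[ℂ] predual X := (pairing X).codRestrict _ pairing_mem_predual
  obtain ⟨μ, hμ⟩ := exists_forall_eq_integral (ξ.comp J)
  refine ⟨μ, ContinuousLinearMap.ext fun p => ?_⟩
  obtain ⟨-, f, rfl⟩ := p
  exact (hμ f).symm

theorem completeSpace : CompleteSpace (RegMeas X) := by
  obtain ⟨e, -⟩ := exists_linearIsometryEquiv_dual_predual (X := X)
  exact e.toIsometryEquiv.completeSpace

theorem ext_integral {μ ν : RegMeas X} (h : ∀ f : C₀(X, ℂ), μ.integral f = ν.integral f) :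
    μ = ν := by
  obtain ⟨e, he⟩ := exists_linearIsometryEquiv_dual_predual (X := X)
  refine e.injective (ContinuousLinearMap.ext fun p => ?_)
  obtain ⟨-, f, rfl⟩ := p
  rw [he, he]
  exact h f

end Duality

/-! ### Integration of separately `C₀` functions -/

section SeparatelyC0

variable {X Y Z : Type*} [TopologicalSpace X] [T2Space X] [LocallyCompactSpace X]
  [TopologicalSpace Y] [T2Space Y] [LocallyCompactSpace Y] [TopologicalSpace Z] [T2Space Z]

/-- A separately `C₀` function as a bounded family of functions in `C₀(Y)`. -/
theorem exists_curry_of_mem_SC0 {f : X × Y → ℂ} (hf : f ∈ SC0 X Y) :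
    ∃ (F : X → C₀(Y, ℂ)) (C : ℝ), (∀ x y, F x y = f (x, y)) ∧
      (∀ y, ∃ g : C₀(X, ℂ), ∀ x, g x = F x y) ∧ (∀ x, ‖F x‖ ≤ C) ∧ ∀ p, ‖f p‖ ≤ C := by
  obtain ⟨⟨C, hC⟩, h1, h2⟩ := hf
  choose F hF using h1
  refine ⟨F, max C 0, hF, fun y => ?_, fun x => ?_, fun p => (hC p).trans (le_max_left _ _)⟩
  · obtain ⟨g, hg⟩ := h2 y
    exact ⟨g, fun x => by rw [hg, hF]⟩
  · refine norm_le_of_forall_le _ (le_max_right _ _) fun y => ?_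
    rw [hF]
    exact (hC _).trans (le_max_left _ _)

theorem swap_mem_SC0 {f : X × Y → ℂ} (hf : f ∈ SC0 X Y) : (fun p => f p.swap) ∈ SC0 Y X :=
  ⟨hf.1.imp fun _ h _ => h _, hf.2.2, hf.2.1⟩

theorem integrableFun_of_mem_SC0 {f : X × Y → ℂ} (hf : f ∈ SC0 X Y) (μ : RegMeas (X × Y)) :
    μ.IntegrableFun f := by
  letI : MeasurableSpace X := borel X
  haveI : BorelSpace X := ⟨rfl⟩
  letI : MeasurableSpace Y := borel Y
  haveI : BorelSpace Y := ⟨rfl⟩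
  letI : MeasurableSpace (X × Y) := borel (X × Y)
  haveI : BorelSpace (X × Y) := ⟨rfl⟩
  have := isFiniteMeasure_tv μ
  have := regular_tv μ
  obtain ⟨F, C, hF, hF', hFC, hC⟩ := exists_curry_of_mem_SC0 hf
  have h := aestronglyMeasurable_comp_separately hF' hFC continuous_fst continuous_snd μ.tv
  simp_rw [hF] at h
  exact Integrable.of_bound h C (.of_forall hC)

/-- The marginal integrals of a separately `C₀` function are in `C₀`, and the order of integration
can be interchanged. -/
theorem exists_marginal_integral {f : X × Y → ℂ} (hf : f ∈ SC0 X Y) (μ : RegMeas X) :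
    ∃ g : C₀(Y, ℂ), (∀ y, g y = μ.integral fun x => f (x, y)) ∧
      ∀ ν : RegMeas Y, ν.integral g = μ.integral fun x => ν.integral fun y => f (x, y) := by
  letI : MeasurableSpace X := borel X
  haveI : BorelSpace X := ⟨rfl⟩
  have : IsFiniteMeasure μ.toMeas.variation := isFiniteMeasure_tv μ
  have : μ.toMeas.variation.Regular := regular_tv μ
  obtain ⟨F, C, hF, hF', hFC, -⟩ := exists_curry_of_mem_SC0 hf
  have hint : Integrable F μ.toMeas.variation :=
    Integrable.of_bound (aestronglyMeasurable_separately hF' hFC _) C (.of_forall hFC)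
  obtain ⟨g, hg⟩ := exists_forall_apply_eq_cint μ.toMeas hint
  have key : ∀ ν : RegMeas Y, ν.integral g = μ.integral fun x => ν.integral fun y => f (x, y) := by
    intro ν
    have h := hg ((pairing Y).flip ν)
    simp only [← hF]
    exact h
  refine ⟨g, fun y => ?_, key⟩
  have h := key (dirac y)
  simp only [integral_dirac] at h
  exact h

theorem integral_integral_swap {f : X × Y → ℂ} (hf : f ∈ SC0 X Y) (μ : RegMeas X)
    (ν : RegMeas Y) : (ν.integral fun y => μ.integral fun x => f (x, y)) =
      μ.integral fun x => ν.integral fun y => f (x, y) := by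
  obtain ⟨g, hg, hg'⟩ := exists_marginal_integral hf μ
  rw [← hg']
  simp_rw [← hg]

theorem integral_pushProd_of_aestronglyMeasurable (φ : C(X × Y, Z)) (μ : RegMeas X) (ν : RegMeas Y)
    {g : Z → ℂ} {C : ℝ} (hC : ∀ z, ‖g z‖ ≤ C)
    (hg : letI : MeasurableSpace Z := borel Z
      ∀ (m : Measure Z) [IsFiniteMeasure m] [m.Regular], AEStronglyMeasurable g m) :
    (pushProd φ μ ν).integral g = ν.integral fun y => μ.integral fun x => g (φ (x, y)) := by
  letI : MeasurableSpace X := borel X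
  haveI : BorelSpace X := ⟨rfl⟩
  letI : MeasurableSpace Y := borel Y
  haveI : BorelSpace Y := ⟨rfl⟩
  letI : MeasurableSpace Z := borel Z
  haveI : BorelSpace Z := ⟨rfl⟩
  have : IsFiniteMeasure μ.toMeas.variation := isFiniteMeasure_tv μ
  have : IsFiniteMeasure ν.toMeas.variation := isFiniteMeasure_tv ν
  have : μ.toMeas.variation.Regular := regular_tv μ
  have : ν.toMeas.variation.Regular := regular_tv ν
  have hφ : Continuous (Function.uncurry fun x y => φ (x, y)) := φ.continuous
  have := isFiniteMeasure_pushMeasure hφ μ.toMeas.variation ν.toMeas.variation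
  have := regular_pushMeasure hφ μ.toMeas.variation ν.toMeas.variation
  exact cint_pushVectorMeasure hφ μ.toMeas μ.regular_tv ν.toMeas (hg _) hC

theorem integral_pushProd (φ : C(X × Y, Z)) (μ : RegMeas X) (ν : RegMeas Y) (g : C₀(Z, ℂ)) :
    (pushProd φ μ ν).integral g = ν.integral fun y => μ.integral fun x => g (φ (x, y)) := by
  letI : MeasurableSpace Z := borel Z
  haveI : BorelSpace Z := ⟨rfl⟩
  exact integral_pushProd_of_aestronglyMeasurable φ μ ν (norm_apply_le_norm g)
    fun m _ _ => g.continuous.measurable.aestronglyMeasurable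

/-- Iterated integration of separately `C₀` functions. They need not be Borel functions, but they are
measurable for every finite regular measure. -/
theorem integral_pushProd_of_mem_SC0 {U V : Type*} [TopologicalSpace U] [T2Space U]
    [LocallyCompactSpace U] [TopologicalSpace V] [T2Space V] [LocallyCompactSpace V]
    (φ : C(X × Y, U × V)) (μ : RegMeas X) (ν : RegMeas Y) {f : U × V → ℂ} (hf : f ∈ SC0 U V) :
    (pushProd φ μ ν).integral f = ν.integral fun y => μ.integral fun x => f (φ (x, y)) := by
  letI : MeasurableSpace U := borel U
  haveI : BorelSpace U := ⟨rfl⟩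
  letI : MeasurableSpace V := borel V
  haveI : BorelSpace V := ⟨rfl⟩
  letI : MeasurableSpace (U × V) := borel (U × V)
  haveI : BorelSpace (U × V) := ⟨rfl⟩
  obtain ⟨F, C, hF, hF', hFC, hC⟩ := exists_curry_of_mem_SC0 hf
  refine integral_pushProd_of_aestronglyMeasurable φ μ ν hC fun m _ _ => ?_
  have h := aestronglyMeasurable_comp_separately hF' hFC continuous_fst continuous_snd m
  simp_rw [hF] at h
  exact h

end SeparatelyC0

/-! ### Separately proper maps -/

section SeparatelyProper

variable {X Y Z U V W : Type*} [TopologicalSpace X] [TopologicalSpace Y] [TopologicalSpace Z]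
  [TopologicalSpace U] [TopologicalSpace V] [TopologicalSpace W]

/-- The map `φ` on `X × Y` tends to infinity in each variable. Group multiplications and the
associated actions have this property, although in general they are not proper as maps of two
variables. -/
structure SeparatelyProper (φ : C(X × Y, Z)) : Prop where
  left : ∀ x, Tendsto (fun y => φ (x, y)) (cocompact Y) (cocompact Z)
  right : ∀ y, Tendsto (fun x => φ (x, y)) (cocompact X) (cocompact Z)

theorem SeparatelyProper.comp_mem_SC0 {φ : C(X × Y, Z)} (hφ : SeparatelyProper φ)
    (f : C₀(Z, ℂ)) : (fun p => f (φ p)) ∈ SC0 X Y :=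
  ⟨⟨‖f‖, fun _ => norm_apply_le_norm f _⟩,
    fun x => ⟨f.comp ⟨⟨fun y => φ (x, y), by fun_prop⟩, hφ.left x⟩, fun _ => rfl⟩,
    fun y => ⟨f.comp ⟨⟨fun x => φ (x, y), by fun_prop⟩, hφ.right y⟩, fun _ => rfl⟩⟩

variable [T2Space X] [LocallyCompactSpace X] [T2Space Y] [LocallyCompactSpace Y]
  [T2Space Z] [LocallyCompactSpace Z] [T2Space U] [LocallyCompactSpace U]
  [T2Space V] [LocallyCompactSpace V] [T2Space W] [LocallyCompactSpace W]

theorem pushProd_swap {φ : C(X × Y, Z)} {ψ : C(Y × X, Z)} (hφ : SeparatelyProper φ)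
    (h : ∀ x y, φ (x, y) = ψ (y, x)) (μ : RegMeas X) (ν : RegMeas Y) :
    pushProd φ μ ν = pushProd ψ ν μ := by
  refine ext_integral fun f => ?_
  rw [integral_pushProd, integral_pushProd, integral_integral_swap (hφ.comp_mem_SC0 f)]
  simp_rw [h]

/-- An associative law for maps gives one for images of product measures. It is tested on `C₀(Z)`,
where both sides become the same threefold iterated integral. -/
theorem pushProd_assoc {φ : C(U × W, Z)} {ψ : C(X × Y, U)} {φ' : C(X × V, Z)} {ψ' : C(Y × W, V)}
    (hφ : SeparatelyProper φ) (hφ' : SeparatelyProper φ')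
    (h : ∀ x y w, φ (ψ (x, y), w) = φ' (x, ψ' (y, w))) (a : RegMeas X) (b : RegMeas Y)
    (c : RegMeas W) : pushProd φ (pushProd ψ a b) c = pushProd φ' a (pushProd ψ' b c) := by
  refine ext_integral fun f => ?_
  obtain ⟨g, hg, -⟩ := exists_marginal_integral (hφ'.comp_mem_SC0 f) a
  have h1 : ∀ w, ((pushProd ψ a b).integral fun u => f (φ (u, w))) =
      b.integral fun y => a.integral fun x => f (φ (ψ (x, y), w)) := fun w => by
    obtain ⟨k, hk⟩ := (hφ.comp_mem_SC0 f).2.2 w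
    simp_rw [← hk]
    exact integral_pushProd ψ a b k
  rw [integral_pushProd, integral_pushProd]
  simp_rw [h1, ← hg]
  rw [integral_pushProd]
  simp_rw [hg, h]

/-- The image of a product measure is `w^*`-continuous in its second factor. -/
theorem comp_pushProd_mem_predual {φ : C(X × Y, Z)} (hφ : SeparatelyProper φ) (μ : RegMeas X)
    {p : StrongDual ℂ (RegMeas Z)} (hp : p ∈ predual Z) : p.comp (pushProd φ μ) ∈ predual Y := by
  obtain ⟨f, rfl⟩ := hp
  obtain ⟨g, hg, -⟩ := exists_marginal_integral (hφ.comp_mem_SC0 f) μ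
  refine ⟨g, ContinuousLinearMap.ext fun ν => ?_⟩
  change ν.integral g = (pushProd φ μ ν).integral f
  rw [integral_pushProd]
  simp_rw [← hg]

/-- The image of a product measure is `w^*`-continuous in its first factor; as the inner integral is
over that factor, this uses the interchange of integrals. -/
theorem comp_flip_pushProd_mem_predual {φ : C(X × Y, Z)} (hφ : SeparatelyProper φ) (ν : RegMeas Y)
    {p : StrongDual ℂ (RegMeas Z)} (hp : p ∈ predual Z) :
    p.comp ((pushProd φ).flip ν) ∈ predual X := by
  obtain ⟨f, rfl⟩ := hp
  obtain ⟨g, hg, hg'⟩ := exists_marginal_integral (swap_mem_SC0 (hφ.comp_mem_SC0 f)) ν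
  refine ⟨g, ContinuousLinearMap.ext fun μ => ?_⟩
  change μ.integral g = (pushProd φ μ ν).integral f
  rw [integral_pushProd, hg']
  rfl

end SeparatelyProper

end RegMeas

/-! ### Functionals and forms that are continuous for the `w^*`-topology -/

section WeakStar

variable {A B E : Type*} [NormedAddCommGroup A] [NormedSpace ℂ A]
  [NormedAddCommGroup B] [NormedSpace ℂ B] [NormedAddCommGroup E] [NormedSpace ℂ E]

/-- A `w^*`-continuous functional belongs to the predual. -/
theorem continuous_weakStar_iff_mem (P : Submodule ℂ (StrongDual ℂ A)) (φ : StrongDual ℂ A) :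
    Continuous[weakStar P, inferInstance] φ ↔ φ ∈ P := by
  let f : P → A →ₗ[ℂ] ℂ := fun p => p.1.toLinearMap
  have h1 : weakStar P = ⨅ p, TopologicalSpace.induced (f p) inferInstance := induced_to_pi _
  have h2 : φ.toLinearMap ∈ Submodule.span ℂ (range f) ↔ φ ∈ P := by
    have h3 : range f = (P.map (ContinuousLinearMap.coeLM ℂ) : Submodule ℂ (A →ₗ[ℂ] ℂ)) := by
      ext ψ
      simp [f]
    rw [h3, Submodule.span_eq]
    refine ⟨?_, fun h => ⟨φ, h, rfl⟩⟩
    rintro ⟨ψ, hψ, h⟩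
    rwa [← ContinuousLinearMap.coe_injective h]
  rw [h1, ← h2, LinearMap.mem_span_iff_continuous]
  rfl

theorem continuous_weakStar_of_comp_mem {P : Submodule ℂ (StrongDual ℂ A)}
    {Q : Submodule ℂ (StrongDual ℂ E)} (T : A →L[ℂ] E) (h : ∀ q ∈ Q, q.comp T ∈ P) :
    Continuous[weakStar P, weakStar Q] T := by
  refine continuous_induced_rng.2 ?_
  refine (@continuous_pi_iff A Q (fun _ => ℂ) (weakStar P) _ _).2 fun q => ?_
  exact (continuous_weakStar_iff_mem P (q.1.comp T)).2 (h q q.2)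

theorem mem_separatelyWeakStar_iff {PA : Submodule ℂ (StrongDual ℂ A)}
    {PB : Submodule ℂ (StrongDual ℂ B)} {Φ : A →L[ℂ] B →L[ℂ] ℂ} :
    Φ ∈ separatelyWeakStar PA PB ↔ (∀ y, Φ.flip y ∈ PA) ∧ ∀ x, Φ x ∈ PB := by
  simp_rw [← continuous_weakStar_iff_mem]
  rfl

theorem isClosed_separatelyWeakStar {PA : Submodule ℂ (StrongDual ℂ A)}
    {PB : Submodule ℂ (StrongDual ℂ B)} (hA : IsClosed (PA : Set (StrongDual ℂ A)))
    (hB : IsClosed (PB : Set (StrongDual ℂ B))) :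
    IsClosed (separatelyWeakStar PA PB : Set (A →L[ℂ] B →L[ℂ] ℂ)) := by
  have h : (separatelyWeakStar PA PB : Set (A →L[ℂ] B →L[ℂ] ℂ)) =
      (⋂ y, {Φ | Φ.flip y ∈ PA}) ∩ ⋂ x, {Φ | Φ x ∈ PB} := by
    ext Φ
    simp only [SetLike.mem_coe, mem_separatelyWeakStar_iff, mem_inter_iff, mem_iInter,
      mem_ofPred_eq]
  rw [h]
  refine (isClosed_iInter fun y => hA.preimage ?_).inter (isClosed_iInter fun x => hB.preimage ?_)
  · exact (((ContinuousLinearMap.flipₗᵢ ℂ A B ℂ).continuous).clm_apply continuous_const)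
  · exact continuous_id.clm_apply continuous_const

theorem formRight_mem {PA : Submodule ℂ (StrongDual ℂ A)} {PB : Submodule ℂ (StrongDual ℂ B)}
    {mA : A →L[ℂ] A →L[ℂ] A} (h : ∀ a, ∀ p ∈ PA, p.comp (mA a) ∈ PA) (a : A)
    {Φ : A →L[ℂ] B →L[ℂ] ℂ} (hΦ : Φ ∈ separatelyWeakStar PA PB) :
    formRight B mA a Φ ∈ separatelyWeakStar PA PB := by
  rw [mem_separatelyWeakStar_iff] at hΦ ⊢
  exact ⟨fun y => h a _ (hΦ.1 y), fun x => hΦ.2 (mA a x)⟩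

theorem formLeft_mem {PA : Submodule ℂ (StrongDual ℂ A)} {PB : Submodule ℂ (StrongDual ℂ B)}
    {mB : B →L[ℂ] B →L[ℂ] B} (h : ∀ b, ∀ p ∈ PB, p.comp (mB.flip b) ∈ PB) (b : B)
    {Φ : A →L[ℂ] B →L[ℂ] ℂ} (hΦ : Φ ∈ separatelyWeakStar PA PB) :
    formLeft A mB b Φ ∈ separatelyWeakStar PA PB := by
  rw [mem_separatelyWeakStar_iff] at hΦ ⊢
  exact ⟨fun y => hΦ.1 (mB y b), fun x => h b _ (hΦ.2 x)⟩

theorem isBanachBimodule_dualAction {PA : Submodule ℂ (StrongDual ℂ A)}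
    {PB : Submodule ℂ (StrongDual ℂ B)} {mA : A →L[ℂ] A →L[ℂ] A} {mB : B →L[ℂ] B →L[ℂ] B}
    (hmA : ∀ a b c, mA (mA a b) c = mA a (mA b c)) (hmB : ∀ a b c, mB (mB a b) c = mB a (mB b c))
    (hA : ∀ a, ∀ Φ ∈ separatelyWeakStar PA PB, formRight B mA a Φ ∈ separatelyWeakStar PA PB)
    (hB : ∀ b, ∀ Φ ∈ separatelyWeakStar PA PB, formLeft A mB b Φ ∈ separatelyWeakStar PA PB) :
    IsBanachBimodule mA mB (dualAction (formRight B mA) _ hA) (dualAction (formLeft A mB) _ hB) where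
  complete := inferInstance
  left_mul a a' ξ := by
    ext Φ
    simp only [dualAction_apply]
    congr 2
    ext x y
    simp only [formRight_apply, hmA]
  right_mul b b' ξ := by
    ext Φ
    simp only [dualAction_apply]
    congr 2
    ext x y
    simp only [formLeft_apply, hmB]
  comm a b ξ := by
    ext Φ
    simp only [dualAction_apply]
    congr 2

end WeakStar

namespace RegMeas

/-! ### Convolution and the module actions -/

section Actions

theorem tendsto_cocompact_prod_of_fst {α X Y : Type*} [TopologicalSpace X] [TopologicalSpace Y]
    {l : Filter α} {f : α → X × Y} (h : Tendsto (fun a => (f a).1) l (cocompact X)) :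
    Tendsto f l (cocompact (X × Y)) := by
  rw [← coprod_cocompact]
  exact Tendsto.mono_right (tendsto_comap_iff.2 h) le_sup_left

theorem tendsto_cocompact_prod_of_snd {α X Y : Type*} [TopologicalSpace X] [TopologicalSpace Y]
    {l : Filter α} {f : α → X × Y} (h : Tendsto (fun a => (f a).2) l (cocompact Y)) :
    Tendsto f l (cocompact (X × Y)) := by
  rw [← coprod_cocompact]
  exact Tendsto.mono_right (tendsto_comap_iff.2 h) le_sup_right

variable (G H : Type*)
  [Group G] [TopologicalSpace G] [IsTopologicalGroup G]
  [Group H] [TopologicalSpace H] [IsTopologicalGroup H]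

/-- Multiplication on `G`. -/
def mulMap : C(G × G, G) := ⟨fun p => p.1 * p.2, continuous_mul⟩

/-- The left translation action of `G` on `G × H`. -/
def leftMap : C(G × (G × H), G × H) := ⟨fun p => (p.1 * p.2.1, p.2.2), by fun_prop⟩

/-- The right translation action of `H` on `G × H`, with the element of `H` as last argument. -/
def rightMap : C((G × H) × H, G × H) := ⟨fun p => (p.1.1, p.1.2 * p.2), by fun_prop⟩

/-- The right translation action of `H` on `G × H`, with the element of `H` as first argument. -/
def rightMapSwap : C(H × (G × H), G × H) := ⟨fun p => (p.2.1, p.2.2 * p.1), by fun_prop⟩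

theorem separatelyProper_mulMap : SeparatelyProper (mulMap G) :=
  ⟨fun x => (Homeomorph.mulLeft x).isClosedEmbedding.tendsto_cocompact,
    fun y => (Homeomorph.mulRight y).isClosedEmbedding.tendsto_cocompact⟩

theorem separatelyProper_leftMap : SeparatelyProper (leftMap G H) :=
  ⟨fun x => ((Homeomorph.mulLeft x).prodCongr (.refl H)).isClosedEmbedding.tendsto_cocompact,
    fun y => tendsto_cocompact_prod_of_fst
      (Homeomorph.mulRight y.1).isClosedEmbedding.tendsto_cocompact⟩

theorem separatelyProper_rightMap : SeparatelyProper (rightMap G H) :=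
  ⟨fun x => tendsto_cocompact_prod_of_snd
      (Homeomorph.mulLeft x.2).isClosedEmbedding.tendsto_cocompact,
    fun y => ((Homeomorph.refl G).prodCongr
      (Homeomorph.mulRight y)).isClosedEmbedding.tendsto_cocompact⟩

theorem separatelyProper_rightMapSwap : SeparatelyProper (rightMapSwap G H) :=
  ⟨(separatelyProper_rightMap G H).right, (separatelyProper_rightMap G H).left⟩

variable [T2Space G] [LocallyCompactSpace G] [T2Space H] [LocallyCompactSpace H]

theorem conv_eq : conv G = pushProd (mulMap G) := rfl

theorem conv_assoc (a b c : RegMeas G) : conv G (conv G a b) c = conv G a (conv G b c) :=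
  pushProd_assoc (separatelyProper_mulMap G) (separatelyProper_mulMap G) mul_assoc a b c

theorem leftAct_eq : leftAct G H = pushProd (leftMap G H) := by
  ext a ν : 2
  refine ext_integral fun f => ?_
  rw [leftAct_apply, conv_eq, integral_pushProd, integral_pushProd]
  congr 1
  ext p
  obtain ⟨k, hk⟩ := ((separatelyProper_mulMap (G × H)).comp_mem_SC0 f).2.2 p
  simp_rw [← hk]
  rw [tensor, integral_pushProd, integral_dirac]
  simp [hk, mulMap, leftMap, Prod.mul_def]

theorem rightAct_eq : rightAct G H = pushProd (rightMapSwap G H) := by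
  ext b ν : 2
  refine ext_integral fun f => ?_
  rw [rightAct_apply, conv_eq, integral_pushProd, integral_pushProd,
    integral_integral_swap ((separatelyProper_mulMap (G × H)).comp_mem_SC0 f)]
  congr 1
  ext p
  obtain ⟨k, hk⟩ := ((separatelyProper_mulMap (G × H)).comp_mem_SC0 f).2.1 p
  simp_rw [← hk]
  rw [tensor, integral_pushProd]
  simp_rw [integral_dirac]
  simp [hk, mulMap, rightMapSwap, Prod.mul_def]

/-- The right action with its factors in the order in which they act, as associativity needs them;
the two orders agree by the interchange of integrals. -/
theorem rightAct_apply_eq (b : RegMeas H) (ν : RegMeas (G × H)) :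
    rightAct G H b ν = pushProd (rightMap G H) ν b := by
  rw [rightAct_eq]
  exact pushProd_swap (separatelyProper_rightMapSwap G H) (fun _ _ => rfl) b ν

theorem isBanachBimodule : IsBanachBimodule (conv G) (conv H) (leftAct G H) (rightAct G H) where
  complete := completeSpace
  left_mul a a' x := by
    rw [leftAct_eq]
    exact pushProd_assoc (ψ := mulMap G) (ψ' := leftMap G H) (separatelyProper_leftMap G H)
      (separatelyProper_leftMap G H) (fun k k' p => Prod.ext (mul_assoc k k' p.1) rfl) a a' x
  right_mul b b' x := by
    simp_rw [rightAct_apply_eq]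
    exact (pushProd_assoc (ψ := rightMap G H) (ψ' := mulMap H) (separatelyProper_rightMap G H)
      (separatelyProper_rightMap G H) (fun p k k' => Prod.ext rfl (mul_assoc p.2 k k')) x b b').symm
  comm a b x := by
    simp_rw [rightAct_apply_eq, leftAct_eq]
    exact pushProd_assoc (separatelyProper_rightMap G H) (separatelyProper_leftMap G H)
      (fun k p k' => rfl) a x b

theorem isBanachBimodule_conv : IsBanachBimodule (conv G) (conv G) (conv G) (conv G).flip where
  complete := completeSpace
  left_mul := conv_assoc G
  right_mul b b' x := (conv_assoc G x b b').symm
  comm a b x := conv_assoc G a x b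

theorem isDualBanachAlgebra_conv : IsDualBanachAlgebra (conv G) (predual G) where
  complete := completeSpace
  assoc := conv_assoc G
  norm_le a b := norm_pushProdFun_le (mulMap G) a b
  dualBimodule :=
    { isBanachBimodule_conv G with
      isClosed := isClosed_predual
      left_mem := fun b _ hp => comp_flip_pushProd_mem_predual (separatelyProper_mulMap G) b hp
      right_mem := fun a _ hp => comp_pushProd_mem_predual (separatelyProper_mulMap G) a hp
      dual := exists_linearIsometryEquiv_dual_predual }

theorem isNormalDualBanachBimodule :
    IsNormalDualBanachBimodule (conv G) (predual G) (conv H) (predual H)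
      (leftAct G H) (rightAct G H) (predual (G × H)) :=
  { isBanachBimodule G H with
    isClosed := isClosed_predual
    left_mem := fun b _ hp => by
      rw [rightAct_eq]
      exact comp_pushProd_mem_predual (separatelyProper_rightMapSwap G H) b hp
    right_mem := fun a _ hp => by
      rw [leftAct_eq]
      exact comp_pushProd_mem_predual (separatelyProper_leftMap G H) a hp
    dual := exists_linearIsometryEquiv_dual_predual
    dualLeft := isDualBanachAlgebra_conv G
    dualRight := isDualBanachAlgebra_conv H
    normal_left := fun x => continuous_weakStar_of_comp_mem ((leftAct G H).flip x) fun _ hq => by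
      rw [leftAct_eq]
      exact comp_flip_pushProd_mem_predual (separatelyProper_leftMap G H) x hq
    normal_right := fun x => continuous_weakStar_of_comp_mem ((rightAct G H).flip x) fun _ hq => by
      rw [rightAct_eq]
      exact comp_flip_pushProd_mem_predual (separatelyProper_rightMapSwap G H) x hq }

end Actions

/-! ### Separately `w^*`-continuous forms and their kernels -/

section Forms

variable {X Y : Type*} [TopologicalSpace X] [T2Space X] [LocallyCompactSpace X]
  [TopologicalSpace Y] [T2Space Y] [LocallyCompactSpace Y]

/-- A separately `w^*`-continuous form is determined by its values on point masses. -/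
theorem apply_eq_integral_integral {Φ : RegMeas X →L[ℂ] RegMeas Y →L[ℂ] ℂ}
    (hΦ : Φ ∈ separatelyWeakStar (predual X) (predual Y)) (μ : RegMeas X) (ν : RegMeas Y) :
    Φ μ ν = ν.integral fun y => μ.integral fun x => Φ (dirac x) (dirac y) := by
  rw [mem_separatelyWeakStar_iff] at hΦ
  obtain ⟨h, hh⟩ := hΦ.2 μ
  have h1 : ∀ y, h y = μ.integral fun x => Φ (dirac x) (dirac y) := fun y => by
    obtain ⟨g, hg⟩ := hΦ.1 (dirac y)
    have e1 : h y = Φ μ (dirac y) := by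
      rw [← hh]
      exact (integral_dirac y h).symm
    have e2 : ∀ x, g x = Φ (dirac x) (dirac y) := fun x => by
      have := congrArg (fun p : StrongDual ℂ (RegMeas X) => p (dirac x)) hg
      exact (integral_dirac x g).symm.trans this
    have e3 : μ.integral g = Φ μ (dirac y) := congrArg (fun p : StrongDual ℂ (RegMeas X) => p μ) hg
    simp_rw [e1, ← e2]
    exact e3.symm
  simp_rw [← h1]
  exact (congrArg (fun p : StrongDual ℂ (RegMeas Y) => p ν) hh).symm

/-- The separately `C₀` function `(x, y) ↦ Φ(δ_x, δ_y)` of a separately `w^*`-continuous form. -/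
noncomputable def formKernel (X Y : Type*) [TopologicalSpace X] [T2Space X]
    [TopologicalSpace Y] [T2Space Y] :
    separatelyWeakStar (predual X) (predual Y) →ₗ[ℂ] SC0 X Y where
  toFun Φ := ⟨fun p => Φ.1 (dirac p.1) (dirac p.2), ⟨‖Φ.1‖, fun p => by
      have h := Φ.1.le_opNorm₂ (dirac p.1) (dirac p.2)
      rwa [norm_dirac, norm_dirac, mul_one, mul_one] at h⟩,
    fun x => by
      obtain ⟨g, hg⟩ := (mem_separatelyWeakStar_iff.1 Φ.2).2 (dirac x)
      refine ⟨g, fun y => ?_⟩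
      change _ = Φ.1 (dirac x) (dirac y)
      rw [← hg]
      exact (integral_dirac y g).symm,
    fun y => by
      obtain ⟨g, hg⟩ := (mem_separatelyWeakStar_iff.1 Φ.2).1 (dirac y)
      refine ⟨g, fun x => ?_⟩
      change _ = Φ.1.flip (dirac y) (dirac x)
      rw [← hg]
      exact (integral_dirac x g).symm⟩
  map_add' _ _ := rfl
  map_smul' _ _ := rfl

/-- Every separately `C₀` function is the kernel of a separately `w^*`-continuous form. -/
theorem exists_form_of_mem_SC0 {f : X × Y → ℂ} (hf : f ∈ SC0 X Y) :
    ∃ Φ ∈ separatelyWeakStar (predual X) (predual Y),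
      ∀ x y, Φ (dirac x) (dirac y) = f (x, y) := by
  -- the form is `(μ, ν) ↦ ∫ M μ dν` with the marginal integral `M μ = ∫ f(x, ·) dμ(x)` in `C₀(Y)`
  choose M hM hM' using exists_marginal_integral hf
  choose k hk using hf.2.2
  obtain ⟨C, hC⟩ := hf.1
  have hM2 : ∀ μ y, M μ y = pairing X (k y) μ := fun μ y => by
    rw [hM]
    simp_rw [← hk]
    rfl
  let T : RegMeas X →L[ℂ] C₀(Y, ℂ) := LinearMap.mkContinuous
    { toFun := M
      map_add' := fun μ μ' => ZeroAtInftyContinuousMap.ext fun y => by simp [hM2]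
      map_smul' := fun c μ => ZeroAtInftyContinuousMap.ext fun y => by simp [hM2] }
    (max C 0) fun μ => norm_le_of_forall_le _
      (mul_nonneg (le_max_right _ _) (norm_nonneg _)) fun y => by
        change ‖M μ y‖ ≤ _
        rw [hM]
        exact norm_integral_le _ _ _ (le_max_right _ _) fun x => (hC _).trans (le_max_left _ _)
  refine ⟨(pairing Y).comp T, mem_separatelyWeakStar_iff.2 ⟨fun ν => ?_, fun μ => ⟨M μ, rfl⟩⟩,
    fun x y => ?_⟩
  · obtain ⟨g, hg, -⟩ := exists_marginal_integral (swap_mem_SC0 hf) ν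
    refine ⟨g, ContinuousLinearMap.ext fun μ => ?_⟩
    change μ.integral g = ν.integral (M μ)
    rw [hM']
    exact congrArg μ.integral (funext hg)
  · change (dirac y).integral (M (dirac x)) = f (x, y)
    rw [integral_dirac, hM, integral_dirac]

theorem bijective_formKernel : Function.Bijective (formKernel X Y) := by
  refine ⟨fun Φ Φ' h => Subtype.ext ?_, fun f => ?_⟩
  · ext μ ν
    rw [apply_eq_integral_integral Φ.2, apply_eq_integral_integral Φ'.2]
    have h' : ∀ x y, Φ.1 (dirac x) (dirac y) = Φ'.1 (dirac x) (dirac y) := fun x y =>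
      congrFun (congrArg Subtype.val h) (x, y)
    exact congrArg ν.integral (funext fun y => congrArg μ.integral (funext fun x => h' x y))
  · obtain ⟨Φ, hΦ, h⟩ := exists_form_of_mem_SC0 f.2
    exact ⟨⟨Φ, hΦ⟩, Subtype.ext (funext fun p => h p.1 p.2)⟩

theorem bddAbove_range_norm (f : SC0 X Y) : BddAbove (range fun p => ‖f.1 p‖) := by
  obtain ⟨C, hC⟩ := f.2.1
  exact ⟨C, by rintro - ⟨p, rfl⟩; exact hC p⟩

theorem norm_eq_iSup_formKernel (Φ : separatelyWeakStar (predual X) (predual Y)) :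
    ‖Φ‖ = ⨆ p, ‖(formKernel X Y Φ).1 p‖ := by
  have h0 : 0 ≤ ⨆ p, ‖(formKernel X Y Φ).1 p‖ := Real.iSup_nonneg fun _ => norm_nonneg _
  refine le_antisymm ?_ ?_
  · refine ContinuousLinearMap.opNorm_le_bound₂ _ h0 fun μ ν => ?_
    change ‖Φ.1 μ ν‖ ≤ _
    rw [apply_eq_integral_integral Φ.2]
    refine norm_integral_le _ _ _ (mul_nonneg h0 (norm_nonneg _)) fun y => ?_
    exact norm_integral_le _ _ _ h0 fun x =>
      le_ciSup (bddAbove_range_norm (formKernel X Y Φ)) (x, y)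
  · refine Real.iSup_le (fun p => ?_) (norm_nonneg _)
    have h := Φ.1.le_opNorm₂ (dirac p.1) (dirac p.2)
    rwa [norm_dirac, norm_dirac, mul_one, mul_one] at h

theorem norm_integral_formKernel_le (μ : RegMeas (X × Y))
    (Φ : separatelyWeakStar (predual X) (predual Y)) :
    ‖μ.integral (formKernel X Y Φ).1‖ ≤ ‖μ‖ * ‖Φ‖ := by
  rw [mul_comm]
  refine norm_integral_le _ _ _ (norm_nonneg _) fun p => ?_
  rw [norm_eq_iSup_formKernel]
  exact le_ciSup (bddAbove_range_norm (formKernel X Y Φ)) p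

/-- Integration of kernels embeds `M(X × Y)` isometrically into the dual of the space of separately
`w^*`-continuous forms: the functions in `C₀(X × Y)` already compute the norm of a measure. -/
theorem exists_linearIsometry_integral_formKernel :
    ∃ Ψ : RegMeas (X × Y) →ₗᵢ[ℂ] StrongDual ℂ (separatelyWeakStar (predual X) (predual Y)),
      ∀ μ Φ, Ψ μ Φ = μ.integral (formKernel X Y Φ).1 := by
  have hint := fun (μ : RegMeas (X × Y)) (Φ : separatelyWeakStar (predual X) (predual Y)) =>
    integrableFun_of_mem_SC0 (formKernel X Y Φ).2 μ
  let Ψ₀ : RegMeas (X × Y) →L[ℂ] StrongDual ℂ (separatelyWeakStar (predual X) (predual Y)) :=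
    LinearMap.mkContinuous₂
      (LinearMap.mk₂ ℂ (fun μ Φ => μ.integral (formKernel X Y Φ).1)
        (fun μ μ' Φ => @VectorMeasure.integral_add_vectorMeasure (X × Y) ℂ ℂ ℂ (borel (X × Y))
          _ _ _ _ _ _ _ μ.toMeas μ'.toMeas (ContinuousLinearMap.mul ℝ ℂ) (hint μ Φ) (hint μ' Φ))
        (fun c μ Φ => @integral_smul_meas (X × Y) (borel (X × Y)) μ.toMeas _ c (hint μ Φ))
        (fun μ Φ Φ' => @VectorMeasure.integral_add (X × Y) ℂ ℂ ℂ (borel (X × Y)) _ _ _ _ _ _ _ _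
          μ.toMeas (ContinuousLinearMap.mul ℝ ℂ) (hint μ Φ) (hint μ Φ'))
        (fun c μ Φ => @integral_const_smul (X × Y) (borel (X × Y)) μ.toMeas _ c))
      1 fun μ Φ => by
        rw [one_mul]
        exact norm_integral_formKernel_le μ Φ
  have hΨ : ∀ μ Φ, Ψ₀ μ Φ = μ.integral (formKernel X Y Φ).1 := fun _ _ => rfl
  refine ⟨⟨Ψ₀.toLinearMap, fun μ => le_antisymm ?_ ?_⟩, fun _ _ => rfl⟩
  · exact ContinuousLinearMap.opNorm_le_bound _ (norm_nonneg _) fun Φ =>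
      norm_integral_formKernel_le μ Φ
  · refine le_of_forall_pos_le_add fun ε hε => ?_
    obtain ⟨f, hf, hle⟩ := exists_norm_le_norm_integral_add μ hε
    refine hle.trans (add_le_add_left ?_ ε)
    have hfS : (f : X × Y → ℂ) ∈ SC0 X Y := by
      have hid : SeparatelyProper (ContinuousMap.id (X × Y)) :=
        ⟨fun _ => tendsto_cocompact_prod_of_snd tendsto_id,
          fun _ => tendsto_cocompact_prod_of_fst tendsto_id⟩
      exact hid.comp_mem_SC0 f
    obtain ⟨Φ, hΦ⟩ := bijective_formKernel.2 ⟨f, hfS⟩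
    have h := (Ψ₀ μ).le_opNorm Φ
    rw [hΨ, hΦ] at h
    refine h.trans (mul_le_of_le_one_right (norm_nonneg _) ?_)
    rw [norm_eq_iSup_formKernel, hΦ]
    exact Real.iSup_le (fun p => (norm_apply_le_norm f p).trans hf) zero_le_one

end Forms

/-! ### Module actions on forms in terms of kernels -/

section FormActions

variable {G H : Type*}
  [Group G] [TopologicalSpace G] [IsTopologicalGroup G] [T2Space G] [LocallyCompactSpace G]
  [Group H] [TopologicalSpace H] [IsTopologicalGroup H] [T2Space H] [LocallyCompactSpace H]

theorem formRight_apply_dirac {Φ : RegMeas G →L[ℂ] RegMeas H →L[ℂ] ℂ}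
    (hΦ : Φ ∈ separatelyWeakStar (predual G) (predual H)) (a : RegMeas G) (x : G) (y : H) :
    formRight (RegMeas H) (conv G) a Φ (dirac x) (dirac y) =
      a.integral fun k => Φ (dirac (k * x)) (dirac y) := by
  obtain ⟨g, hg⟩ := (formKernel G H ⟨Φ, hΦ⟩).2.2.2 y
  have hg : ∀ x, g x = Φ (dirac x) (dirac y) := hg
  rw [formRight_apply, apply_eq_integral_integral hΦ, integral_dirac]
  simp_rw [← hg]
  rw [conv_eq, integral_pushProd, integral_dirac]
  rfl

theorem formLeft_apply_dirac {Φ : RegMeas G →L[ℂ] RegMeas H →L[ℂ] ℂ}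
    (hΦ : Φ ∈ separatelyWeakStar (predual G) (predual H)) (b : RegMeas H) (x : G) (y : H) :
    formLeft (RegMeas G) (conv H) b Φ (dirac x) (dirac y) =
      b.integral fun k => Φ (dirac x) (dirac (y * k)) := by
  obtain ⟨g, hg⟩ := (formKernel G H ⟨Φ, hΦ⟩).2.2.1 x
  have hg : ∀ y, g y = Φ (dirac x) (dirac y) := hg
  rw [formLeft_apply, apply_eq_integral_integral hΦ]
  simp_rw [integral_dirac, ← hg]
  rw [conv_eq, integral_pushProd]
  simp_rw [integral_dirac]
  rfl

end FormActions

end RegMeas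

end MeasAlg

theorem proposition3p2
    {G H : Type*}
    [Group G] [TopologicalSpace G] [IsTopologicalGroup G] [T2Space G] [LocallyCompactSpace G]
    [Group H] [TopologicalSpace H] [IsTopologicalGroup H] [T2Space H] [LocallyCompactSpace H] :
    -- (i) `M(G × H)` is a normal, dual Banach `M(G)`-`M(H)`-bimodule with predual `C₀(G × H)`, ...
    IsNormalDualBanachBimodule (RegMeas.conv G) (RegMeas.predual G)
      (RegMeas.conv H) (RegMeas.predual H)
      (RegMeas.leftAct G H) (RegMeas.rightAct G H) (RegMeas.predual (G × H)) ∧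
    -- ... and its module actions are dual to the convolution actions on `C₀(G × H)`
    (∀ (a : RegMeas G) (ν : RegMeas (G × H)) (f : C₀(G × H, ℂ)),
      (RegMeas.leftAct G H a ν).integral f =
        ν.integral fun p => a.integral fun k => f (k * p.1, p.2)) ∧
    (∀ (b : RegMeas H) (ν : RegMeas (G × H)) (f : C₀(G × H, ℂ)),
      (RegMeas.rightAct G H b ν).integral f =
        ν.integral fun p => b.integral fun k => f (p.1, p.2 * k)) ∧
    -- (ii) the space of bounded separately `w^*`-continuous bilinear forms on `M(G) × M(H)` is a
    -- closed `M(H)`-`M(G)`-submodule of all bounded forms, so that its dual is a Banach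
    -- `M(G)`-`M(H)`-bimodule
    IsClosed (separatelyWeakStar (RegMeas.predual G) (RegMeas.predual H) :
      Set (RegMeas G →L[ℂ] RegMeas H →L[ℂ] ℂ)) ∧
    ∃ (hG : ∀ a, ∀ Φ ∈ separatelyWeakStar (RegMeas.predual G) (RegMeas.predual H),
        formRight (RegMeas H) (RegMeas.conv G) a Φ ∈
          separatelyWeakStar (RegMeas.predual G) (RegMeas.predual H))
      (hH : ∀ b, ∀ Φ ∈ separatelyWeakStar (RegMeas.predual G) (RegMeas.predual H),
        formLeft (RegMeas G) (RegMeas.conv H) b Φ ∈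
          separatelyWeakStar (RegMeas.predual G) (RegMeas.predual H)),
      IsBanachBimodule (RegMeas.conv G) (RegMeas.conv H)
        (dualAction (formRight (RegMeas H) (RegMeas.conv G)) _ hG)
        (dualAction (formLeft (RegMeas G) (RegMeas.conv H)) _ hH) ∧
      -- identification of `SC₀(G × H)` with the separately `w^*`-continuous bilinear forms
      ∃ Φ : SC0 G H ≃ₗ[ℂ] separatelyWeakStar (RegMeas.predual G) (RegMeas.predual H),
        (∀ (f : SC0 G H) (μ : RegMeas G) (ν : RegMeas H),
          (Φ f).1 μ ν = ν.integral fun y => μ.integral fun x => f.1 (x, y)) ∧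
        (∀ f : SC0 G H, ‖Φ f‖ = ⨆ p, ‖f.1 p‖) ∧
        -- `μ ↦ Ψ_μ` is a well-defined isometric homomorphism of `M(G)`-`M(H)`-bimodules
        ∃ Ψ : RegMeas (G × H) →ₗᵢ[ℂ]
            StrongDual ℂ (separatelyWeakStar (RegMeas.predual G) (RegMeas.predual H)),
          (∀ (μ : RegMeas (G × H)) (f : SC0 G H),
            μ.IntegrableFun f.1 ∧ Ψ μ (Φ f) = μ.integral f.1) ∧
          (∀ (a : RegMeas G) (μ : RegMeas (G × H)),
            Ψ (RegMeas.leftAct G H a μ) =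
              dualAction (formRight (RegMeas H) (RegMeas.conv G)) _ hG a (Ψ μ)) ∧
          (∀ (b : RegMeas H) (μ : RegMeas (G × H)),
            Ψ (RegMeas.rightAct G H b μ) =
              dualAction (formLeft (RegMeas G) (RegMeas.conv H)) _ hH b (Ψ μ)) := by
  have hG : ∀ a, ∀ Φ ∈ separatelyWeakStar (RegMeas.predual G) (RegMeas.predual H),
      formRight (RegMeas H) (RegMeas.conv G) a Φ ∈
        separatelyWeakStar (RegMeas.predual G) (RegMeas.predual H) := fun a _ hΦ =>
    formRight_mem (RegMeas.isDualBanachAlgebra_conv G).dualBimodule.right_mem a hΦ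
  have hH : ∀ b, ∀ Φ ∈ separatelyWeakStar (RegMeas.predual G) (RegMeas.predual H),
      formLeft (RegMeas G) (RegMeas.conv H) b Φ ∈
        separatelyWeakStar (RegMeas.predual G) (RegMeas.predual H) := fun b _ hΦ =>
    formLeft_mem (RegMeas.isDualBanachAlgebra_conv H).dualBimodule.left_mem b hΦ
  let Φ := (LinearEquiv.ofBijective _ (RegMeas.bijective_formKernel (X := G) (Y := H))).symm
  have hΦ : ∀ f, RegMeas.formKernel G H (Φ f) = f := fun f =>
    LinearEquiv.apply_symm_apply
      (LinearEquiv.ofBijective _ (RegMeas.bijective_formKernel (X := G) (Y := H))) f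
  obtain ⟨Ψ, hΨ⟩ := RegMeas.exists_linearIsometry_integral_formKernel (X := G) (Y := H)
  refine ⟨RegMeas.isNormalDualBanachBimodule G H, fun a ν f => ?_, fun b ν f => ?_,
    isClosed_separatelyWeakStar RegMeas.isClosed_predual RegMeas.isClosed_predual, hG, hH,
    isBanachBimodule_dualAction (RegMeas.conv_assoc G) (RegMeas.conv_assoc H) hG hH,
    Φ, fun f μ ν => ?_, fun f => ?_, Ψ, fun μ f => ⟨RegMeas.integrableFun_of_mem_SC0 f.2 μ, ?_⟩,
    fun a μ => ContinuousLinearMap.ext fun Θ => ?_, fun b μ => ContinuousLinearMap.ext fun Θ => ?_⟩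
  · rw [RegMeas.leftAct_eq]
    exact RegMeas.integral_pushProd (RegMeas.leftMap G H) a ν f
  · rw [RegMeas.rightAct_eq]
    exact RegMeas.integral_pushProd (RegMeas.rightMapSwap G H) b ν f
  · rw [RegMeas.apply_eq_integral_integral (Φ f).2]
    conv_rhs => rw [← hΦ f]
    rfl
  · rw [RegMeas.norm_eq_iSup_formKernel, hΦ]
  · rw [hΨ, hΦ]
  · rw [dualAction_apply, hΨ, hΨ, RegMeas.leftAct_eq, RegMeas.integral_pushProd_of_mem_SC0 _ _ _
      (RegMeas.formKernel G H Θ).2]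
    congr 1
    ext p
    exact (RegMeas.formRight_apply_dirac Θ.2 a p.1 p.2).symm
  · rw [dualAction_apply, hΨ, hΨ, RegMeas.rightAct_eq, RegMeas.integral_pushProd_of_mem_SC0 _ _ _
      (RegMeas.formKernel G H Θ).2]
    congr 1
    ext p
    exact (RegMeas.formLeft_apply_dirac Θ.2 b p.1 p.2).symm
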